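/- Let $\mathbb K$ be a field of characteristic zero and let $X=(x_1,\dots,x_N)$ be a list of vectors in $\mathbb K^r$ that spans $\mathbb K^r$. Let $M$ be the matroid on $E=\{1,\dots,N\}$ realized by $X$, with rank function $\mathrm{rk}$, and put $$T_X(x,y)=\sum_{A\subseteq E}(x-1)^{r-\mathrm{rk}(A)}(y-1)^{|A|-\mathrm{rk}(A)},\qquad \chi_X(q)=\sum_{A\subseteq E}(-1)^{|A|}q^{r-\mathrm{rk}(A)},\qquad f_X(q)=\sum_{i=0}^r f_i\,q^{r-i},$$ where $f_i$ is the number of independent sets of $M$ of cardinality $i$. Let $X^*$ be any list of $N$ vectors in $\mathbb K^{N-r}$ that realizes the dual matroid $M^*$ (with the same index set $E$). For a finite list $Z$ of vectors in $\mathbb K^s$ and $z\in Z$, let $p_z=\sum_i z_i t_i\in\mathbb K[t_1,\dots,t_s]$. The central zonotopal space of $Z$ is $$\mathcal P(Z)=\mathrm{span}\Bigl\{\prod_{z\in Y}p_z : Y\subseteq Z,\ \mathrm{rk}(Z\setminus Y)=s\Bigr\},$$ and the internal zonotopal space of $Z$ is $$\mathcal P_-(Z)=\bigcap_{z\in Z}\mathcal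 P(Z\setminus z),$$ where $Z\setminus z$ is the list $Z$ with the single entry $z$ removed (and the intersection is all of $\mathbb K[t_1,\dots,t_s]$ if $Z$ is empty). For a graded subspace $V$ of $\mathbb K[t_1,\dots,t_s]$ let $\mathrm{Hilb}(V,t)=\sum_{i\ge0}\dim(V_i)\,t^i$. Then $\mathrm{Hilb}(\mathcal P(X^*),t)$ and $\mathrm{Hilb}(\mathcal P_-(X^*),t)$ are polynomials in $t$, and the following identities hold in the field $\mathbb Q(q)$ of rational functions: $$f_X(q)=T_X(q+1,1)=(q+1)^r\,\mathrm{Hilb}\Bigl(\mathcal P(X^*),\frac1{q+1}\Bigr),$$ $$(-1)^r\chi_X(-q)=T_X(q+1,0)=(q+1)^r\,\mathrm{Hilb}\Bigl(\mathcal P_-(X^*),\frac1{q+1}\Bigr).$$ -/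

import Mathlib

namespace Zonotopal

/-- The matroid realized by a finite list `X` of vectors: its ground set is the index set of the
list, and a set of indices is independent iff the corresponding sublist is linearly independent. -/
noncomputable def vectorMatroid (K : Type*) [Field K] {V : Type*} [AddCommGroup V] [Module K V]
    {ι : Type*} [Finite ι] (X : ι → V) : Matroid ι :=
  (IndepMatroid.ofFinite (E := Set.univ) Set.finite_univ (fun I => LinearIndepOn K X I)
    (linearIndepOn_empty K X)
    (fun _ _ hJ hIJ => hJ.mono hIJ)
    (by
      intro I J hI hJ hlt
      by_contra! hcon
      have hspan : X '' J ⊆ Submodule.span K (X '' I) := by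
        rintro _ ⟨e, heJ, rfl⟩
        by_cases heI : e ∈ I
        · exact Submodule.subset_span ⟨e, heI, rfl⟩
        · by_contra hns
          exact hcon e heJ heI (hI.insert hns)
      have hle : Submodule.span K (X '' J) ≤ Submodule.span K (X '' I) :=
        Submodule.span_le.2 hspan
      have key : ∀ S : Set ι, LinearIndepOn K X S →
          Module.finrank K (Submodule.span K (X '' S)) = S.ncard := by
        intro S hS
        have : Fintype S := Fintype.ofFinite S
        have h := finrank_span_eq_card hS
        rw [← Set.image_eq_range] at h
        rw [h, ← Nat.card_eq_fintype_card, Nat.card_coe_set_eq]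
      have : FiniteDimensional K (Submodule.span K (X '' I)) :=
        FiniteDimensional.span_of_finite K ((Set.toFinite I).image X)
      have hmono := Submodule.finrank_mono hle
      rw [key J hJ, key I hI] at hmono
      omega)
    (fun _ _ => Set.subset_univ _)).matroid

/-- The rank `rk(A)` of a set in a finite matroid, as a natural number. -/
noncomputable def rk {α : Type*} (M : Matroid α) (A : Set α) : ℕ := (M.eRk A).toNat

section MatroidPolynomials

open scoped Classical in
/-- The subsets of the ground set of a matroid on a finite type. -/
noncomputable def subsets {α : Type*} [Fintype α] (M : Matroid α) : Finset (Finset α) :=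
  Finset.univ.filter fun A => (A : Set α) ⊆ M.E

/-- The Tutte polynomial
`T_M(x, y) = ∑_{A ⊆ E} (x - 1)^(r - rk A) (y - 1)^(|A| - rk A)`, where `x = X 0`, `y = X 1`.
The exponents are honest differences because `rk A ≤ r` and `rk A ≤ |A|`. -/
noncomputable def tuttePolynomial {α : Type*} [Fintype α] (M : Matroid α) :
    MvPolynomial (Fin 2) ℤ :=
  ∑ A ∈ subsets M, (MvPolynomial.X 0 - 1) ^ (rk M M.E - rk M A) *
    (MvPolynomial.X 1 - 1) ^ (A.card - rk M A)

/-- The characteristic polynomial `χ_M(q) = ∑_{A ⊆ E} (-1)^|A| q^(r - rk A)`. -/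
noncomputable def charPolynomial {α : Type*} [Fintype α] (M : Matroid α) : Polynomial ℤ :=
  ∑ A ∈ subsets M, (-1) ^ A.card * Polynomial.X ^ (rk M M.E - rk M A)

open scoped Classical in
/-- The entry `f_i` of the `f`-vector: the number of independent sets of cardinality `i`. -/
noncomputable def fVector {α : Type*} [Fintype α] (M : Matroid α) (i : ℕ) : ℕ :=
  (Finset.univ.filter fun A : Finset α => M.Indep (A : Set α) ∧ A.card = i).card

/-- The `f`-polynomial `f_M(q) = ∑_{i=0}^r f_i q^(r - i)`. -/
noncomputable def fPolynomial {α : Type*} [Fintype α] (M : Matroid α) : Polynomial ℤ :=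
  ∑ i ∈ Finset.range (rk M M.E + 1), (fVector M i : Polynomial ℤ) *
    Polynomial.X ^ (rk M M.E - i)

end MatroidPolynomials

section Spaces

/-- The linear form `p_x = ∑_i x_i t_i` attached to a vector `x ∈ K^r`. -/
noncomputable def linForm {K : Type*} [Field K] {r : ℕ} (x : Fin r → K) :
    MvPolynomial (Fin r) K :=
  ∑ i, MvPolynomial.C (x i) * MvPolynomial.X i

/-- The central space `P(X)`, spanned by the products `∏_{x ∈ Y} p_x` over all sublists `Y` of `X`
such that `X \ Y` has rank `r`. -/
noncomputable def centralSpace {K : Type*} [Field K] {r : ℕ} {ι : Type*} (X : ι → Fin r → K) :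
    Submodule K (MvPolynomial (Fin r) K) :=
  Submodule.span K {p | ∃ Y : Finset ι,
    (X '' {i | i ∉ Y}).finrank K = r ∧ p = ∏ i ∈ Y, linForm (X i)}

/-- The internal space of Holtz and Ron, `P_-(X) = ⋂_{y ∈ X} P(X \ y)`, where `X \ y` is the list
`X` with the one entry `y` removed. -/
noncomputable def internalSpace {K : Type*} [Field K] {r : ℕ} {ι : Type*} (X : ι → Fin r → K) :
    Submodule K (MvPolynomial (Fin r) K) :=
  ⨅ y : ι, centralSpace fun i : {i : ι // i ≠ y} => X i

/-- The Hilbert series `∑_i dim(V_i) t^i` of a graded subspace `V` of `K[t_1, …, t_r]`, where `V_i`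
is the space of homogeneous elements of `V` of degree `i`. -/
noncomputable def hilbertSeries {K : Type*} [Field K] {r : ℕ}
    (V : Submodule K (MvPolynomial (Fin r) K)) : PowerSeries ℤ :=
  PowerSeries.mk fun i =>
    (Module.finrank K ↥(V ⊓ MvPolynomial.homogeneousSubmodule (Fin r) K i) : ℤ)

end Spaces

end Zonotopal

/-!
Throughout, `Z` is a list of vectors in `K^s` (eventually the list realizing the dual matroid), and
a direction is a functional `h` on `K^s`. The Hilbert series of the central and internal spaces of
a spanning list with matroid `M` on `N` elements are `t^(N-s) T_M(1, 1/t)` and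
`t^(N-s) T_M(0, 1/t)`; matroid duality, in the form of the rank formula `rankOn_compl_add`, turns
this into the theorem.

*Central space.* A product of linear forms over `Y`, with the complement of `Y` spanning, has degree
in the direction `h` less than the number of vectors of `Z` off the hyperplane `h = 0`. Conversely
these bounds define the central space (`powerSpace_zero_eq_centralOn`). This follows by deletion and
contraction of a nonzero vector `z`: restriction modulo `p_z` gives a sequence
`0 → P(Z \ z)(-1) → P(Z) → P(Z / z) → 0`, which is exact on the right for the spans of
products and exact in the middle for the spaces of polynomials with bounded degrees. The same
sequence gives the recursion for the Hilbert series (`hilbertSeries_centralOn_eq`).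

*Internal space.* It is described by the same degree bounds lowered by one
(`internalSpace_eq_powerSpace`). The sequence of deletion and contraction is still exact on the left
and in the middle, so it bounds the Hilbert series from above
(`coeff_hilbertSeries_powerSpace_one_le`). For the bound from below, take a vector `v` outside all
proper subspaces spanned by sublists. No hyperplane through `v` is spanned by vectors of `Z`, so the
degree bounds of the central space improve by one in the directions vanishing on `v`. Hence the
polynomials of `P(Z)` divisible by `p_v` are exactly `p_v P_-(Z)`, and modulo `p_v` the space
`P(Z)` lands in `P_-(Z / v)`, where the upper bound is available. As `Z / v` realizes the
truncation `M'` of `M`, the identity `T_{M'}(0, y) = y T_M(1, y) - T_M(0, y)`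
(`X_pow_mul_centralPoly`) makes the two bounds meet (`X_pow_mul_hilbertSeries_powerSpace_one`).
-/

namespace Zonotopal

/-! ### Linear forms, linear substitutions and shifts in a direction -/

section LinearForms

variable {K : Type*} [Field K] {s s' : ℕ}

theorem linForm_add (x y : Fin s → K) : linForm (x + y) = linForm x + linForm y := by
  simp [linForm, add_mul, Finset.sum_add_distrib]

theorem linForm_smul (c : K) (x : Fin s → K) :
    linForm (c • x) = MvPolynomial.C c * linForm x := by
  simp [linForm, Finset.mul_sum, mul_assoc]

/-- The assignment `x ↦ p_x` as a linear map. -/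
noncomputable def linFormₗ (K : Type*) [Field K] (s : ℕ) :
    (Fin s → K) →ₗ[K] MvPolynomial (Fin s) K where
  toFun := linForm
  map_add' := linForm_add
  map_smul' c x := by simp [linForm_smul, MvPolynomial.smul_eq_C_mul]

@[simp] theorem linFormₗ_apply (x : Fin s → K) : linFormₗ K s x = linForm x := rfl

@[simp] theorem linForm_zero : linForm (0 : Fin s → K) = 0 := by simp [linForm]

@[simp] theorem linForm_single (i : Fin s) :
    linForm (Pi.single i (1 : K)) = MvPolynomial.X i := by
  classical
  simp [linForm, Pi.single_apply]

theorem linForm_ne_zero {x : Fin s → K} (hx : x ≠ 0) : linForm x ≠ 0 := by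
  classical
  intro h
  apply hx
  funext j
  have := congrArg (MvPolynomial.eval (Pi.single j (1 : K))) h
  simpa [linForm, Pi.single_apply] using this

theorem isHomogeneous_linForm (x : Fin s → K) : (linForm x).IsHomogeneous 1 :=
  MvPolynomial.IsHomogeneous.sum _ _ _ fun i _ => MvPolynomial.isHomogeneous_C_mul_X _ i

/-- The algebra map of polynomial rings induced by a linear map `π`; it sends `p_x` to `p_{π x}`. -/
noncomputable def linSubst (π : (Fin s → K) →ₗ[K] (Fin s' → K)) :
    MvPolynomial (Fin s) K →ₐ[K] MvPolynomial (Fin s') K :=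
  MvPolynomial.aeval fun i => linForm (π (Pi.single i 1))

@[simp] theorem linSubst_linForm (π : (Fin s → K) →ₗ[K] (Fin s' → K)) (x : Fin s → K) :
    linSubst π (linForm x) = linForm (π x) := by
  have : (linSubst π).toLinearMap ∘ₗ linFormₗ K s = linFormₗ K s' ∘ₗ π := by
    refine LinearMap.pi_ext' fun i => LinearMap.ext_ring ?_
    simp [linSubst]
  exact LinearMap.congr_fun this x

theorem isHomogeneous_linSubst (π : (Fin s → K) →ₗ[K] (Fin s' → K))
    {f : MvPolynomial (Fin s) K} {n : ℕ} (hf : f.IsHomogeneous n) :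
    (linSubst π f).IsHomogeneous n := by
  have := hf.aeval (fun i => linForm (π (Pi.single i 1))) fun i => isHomogeneous_linForm _
  rwa [one_mul] at this

/-- If the kernel of a surjection `π` is the line through `z`, then the kernel of the induced map of
polynomial rings is the ideal generated by `p_z`: with a section `σ` of `π`, the substitution
`σ ∘ π` agrees with the identity modulo `p_z` on the variables, hence everywhere. -/
theorem linForm_dvd_of_linSubst_eq_zero {π : (Fin s → K) →ₗ[K] (Fin s' → K)}
    (hπ : Function.Surjective π) {z : Fin s → K} (hz : LinearMap.ker π = Submodule.span K {z})
    {f : MvPolynomial (Fin s) K} (hf : linSubst π f = 0) : linForm z ∣ f := by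
  obtain ⟨σ, hσ⟩ := π.exists_rightInverse_of_surjective (LinearMap.range_eq_top.2 hπ)
  let I : Ideal (MvPolynomial (Fin s) K) := Ideal.span {linForm z}
  have key : (Ideal.Quotient.mkₐ K I).comp ((linSubst σ).comp (linSubst π)) =
      Ideal.Quotient.mkₐ K I := by
    refine MvPolynomial.algHom_ext fun i => ?_
    have hmem : Pi.single i 1 - σ (π (Pi.single i 1)) ∈ LinearMap.ker π := by
      have := LinearMap.congr_fun hσ (π (Pi.single i 1))
      simp only [LinearMap.comp_apply, LinearMap.id_apply] at this
      simp [this]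
    rw [hz, Submodule.mem_span_singleton] at hmem
    obtain ⟨c, hc⟩ := hmem
    have h1 : linForm (Pi.single i 1) - linForm (σ (π (Pi.single i 1))) =
        MvPolynomial.C c * linForm z := by
      rw [← linForm_smul, hc, ← linFormₗ_apply, ← linFormₗ_apply, ← linFormₗ_apply, map_sub]
    rw [AlgHom.comp_apply, AlgHom.comp_apply, ← linForm_single, linSubst_linForm,
      linSubst_linForm]
    refine ((Ideal.Quotient.mk_eq_mk_iff_sub_mem _ _).2 ?_).symm
    rw [h1]
    exact Ideal.mul_mem_left _ _ (Ideal.mem_span_singleton_self _)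
  have := DFunLike.congr_fun key f
  rw [AlgHom.comp_apply, AlgHom.comp_apply, hf, map_zero, map_zero] at this
  exact Ideal.mem_span_singleton.1 (Ideal.Quotient.eq_zero_iff_mem.1 this.symm)

/-- The shift `f ↦ f(x + τ h)` in the direction `h`, as a polynomial in `τ`. Directions are
functionals on the space of vectors, since polynomials in `t_1, …, t_s` are functions on its
dual. -/
noncomputable def dirShift (h : (Fin s → K) →ₗ[K] K) :
    MvPolynomial (Fin s) K →ₐ[K] Polynomial (MvPolynomial (Fin s) K) :=
  MvPolynomial.aeval fun i => Polynomial.C (MvPolynomial.X i) +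
    Polynomial.C (MvPolynomial.C (h (Pi.single i 1))) * Polynomial.X

theorem dirShift_linForm (h : (Fin s → K) →ₗ[K] K) (x : Fin s → K) :
    dirShift h (linForm x) = Polynomial.C (linForm x) +
      Polynomial.C (MvPolynomial.C (h x)) * Polynomial.X := by
  have hx : h x = ∑ i, x i * h (Pi.single i 1) := by
    conv_lhs => rw [← Finset.univ_sum_single x]
    rw [map_sum]
    refine Finset.sum_congr rfl fun i _ => ?_
    rw [← smul_eq_mul, ← map_smul, ← Pi.single_smul, smul_eq_mul, mul_one]
  have hC (c : K) : dirShift h (MvPolynomial.C c) = Polynomial.C (MvPolynomial.C c) := by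
    simp [dirShift]
  have hX (i : Fin s) : dirShift h (MvPolynomial.X i) = Polynomial.C (MvPolynomial.X i) +
      Polynomial.C (MvPolynomial.C (h (Pi.single i 1))) * Polynomial.X := by
    simp [dirShift]
  rw [hx, linForm]
  simp only [map_sum, map_mul, hC, hX, mul_add, Finset.sum_add_distrib, Finset.sum_mul, mul_assoc]

theorem dirShift_injective (h : (Fin s → K) →ₗ[K] K) : Function.Injective (dirShift h) := by
  have key (f : MvPolynomial (Fin s) K) : Polynomial.eval 0 (dirShift h f) = f := by
    have : ((Polynomial.aeval (R := MvPolynomial (Fin s) K) 0).restrictScalars K).comp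
        (dirShift h) = AlgHom.id K _ := by
      refine MvPolynomial.algHom_ext fun i => ?_
      simp [dirShift]
    simpa [Polynomial.aeval_def] using DFunLike.congr_fun this f
  exact Function.LeftInverse.injective key

theorem dirShift_linForm_of_eq_zero {h : (Fin s → K) →ₗ[K] K} {x : Fin s → K} (hx : h x = 0) :
    dirShift h (linForm x) = Polynomial.C (linForm x) := by
  simp [dirShift_linForm, hx]

theorem degree_dirShift_linForm {h : (Fin s → K) →ₗ[K] K} {x : Fin s → K} (hx : h x ≠ 0) :
    (dirShift h (linForm x)).degree = 1 := by
  rw [dirShift_linForm, add_comm]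
  exact Polynomial.degree_linear (by simpa using hx)

theorem degree_dirShift_linForm_mul_of_eq_zero {h : (Fin s → K) →ₗ[K] K} {x : Fin s → K}
    (hx : x ≠ 0) (hhx : h x = 0) (f : MvPolynomial (Fin s) K) :
    (dirShift h (linForm x * f)).degree = (dirShift h f).degree := by
  rw [map_mul, dirShift_linForm_of_eq_zero hhx, Polynomial.degree_mul,
    Polynomial.degree_C (linForm_ne_zero hx), zero_add]

theorem degree_dirShift_linForm_mul {h : (Fin s → K) →ₗ[K] K} {x : Fin s → K}
    (hhx : h x ≠ 0) (f : MvPolynomial (Fin s) K) :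
    (dirShift h (linForm x * f)).degree = (dirShift h f).degree + 1 := by
  rw [map_mul, Polynomial.degree_mul, degree_dirShift_linForm hhx, add_comm]

/-- Compatibility of shifts with linear substitutions: the directions of the quotient of `K^s` by
`ker π` are the directions vanishing on `ker π`. -/
theorem dirShift_linSubst (π : (Fin s → K) →ₗ[K] (Fin s' → K)) (h : (Fin s' → K) →ₗ[K] K)
    (f : MvPolynomial (Fin s) K) :
    dirShift h (linSubst π f) =
      Polynomial.map (linSubst π : MvPolynomial (Fin s) K →+* MvPolynomial (Fin s') K)
        (dirShift (h ∘ₗ π) f) := by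
  have : (dirShift h).comp (linSubst π) =
      (Polynomial.mapAlgHom (linSubst π)).comp (dirShift (h ∘ₗ π)) := by
    refine MvPolynomial.algHom_ext fun i => ?_
    rw [AlgHom.comp_apply, AlgHom.comp_apply, ← linForm_single, linSubst_linForm, dirShift_linForm,
      dirShift_linForm]
    simp only [LinearMap.comp_apply, Polynomial.coe_mapAlgHom, Polynomial.map_add,
      Polynomial.map_mul, Polynomial.map_C, Polynomial.map_X, RingHom.coe_coe, linSubst_linForm]
    rw [← MvPolynomial.algebraMap_eq, ← MvPolynomial.algebraMap_eq, AlgHom.commutes]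
  simpa using DFunLike.congr_fun this f

theorem degree_dirShift_linSubst_le (π : (Fin s → K) →ₗ[K] (Fin s' → K))
    (h : (Fin s' → K) →ₗ[K] K) (f : MvPolynomial (Fin s) K) :
    (dirShift h (linSubst π f)).degree ≤ (dirShift (h ∘ₗ π) f).degree := by
  rw [dirShift_linSubst]
  exact Polynomial.degree_map_le

/-- The quotient by a nonzero vector, in coordinates. -/
theorem exists_surjective_ker_eq_span_singleton {z : Fin (s + 1) → K} (hz : z ≠ 0) :
    ∃ π : (Fin (s + 1) → K) →ₗ[K] (Fin s → K),
      Function.Surjective π ∧ LinearMap.ker π = Submodule.span K {z} := by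
  have h1 := (Submodule.span K {z}).finrank_quotient_add_finrank
  rw [finrank_span_singleton hz, Module.finrank_fin_fun] at h1
  have h2 : Module.finrank K ((Fin (s + 1) → K) ⧸ Submodule.span K {z}) =
      Module.finrank K (Fin s → K) := by
    rw [Module.finrank_fin_fun]; omega
  let e := LinearEquiv.ofFinrankEq _ _ h2
  refine ⟨e.toLinearMap ∘ₗ (Submodule.span K {z}).mkQ, ?_, ?_⟩
  · exact e.surjective.comp (Submodule.mkQ_surjective _)
  · rw [LinearEquiv.ker_comp, Submodule.ker_mkQ]

end LinearForms

/-! ### Dimensions of graded pieces -/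

section GradedPieces

variable {K : Type*} [Field K] {s s' : ℕ}

instance finite_homogeneousSubmodule (n : ℕ) :
    Module.Finite K (MvPolynomial.homogeneousSubmodule (Fin s) K n) :=
  Module.Finite.iff_fg.2 (MvPolynomial.homogeneousSubmodule_fg _ _ n)

/-- The dimension of the degree `n` piece of a subspace of the polynomial ring. -/
noncomputable def hilb (V : Submodule K (MvPolynomial (Fin s) K)) (n : ℕ) : ℕ :=
  Module.finrank K ↥(V ⊓ MvPolynomial.homogeneousSubmodule (Fin s) K n)

theorem coeff_hilbertSeries (V : Submodule K (MvPolynomial (Fin s) K)) (n : ℕ) :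
    PowerSeries.coeff n (hilbertSeries V) = hilb V n := by
  simp [hilbertSeries, hilb]

theorem hilb_bot (n : ℕ) : hilb (⊥ : Submodule K (MvPolynomial (Fin s) K)) n = 0 := by
  simp [hilb]

theorem hilbertSeries_bot : hilbertSeries (⊥ : Submodule K (MvPolynomial (Fin s) K)) = 0 := by
  ext n
  simp [coeff_hilbertSeries, hilb_bot]

/-- A polynomial ring in no variables has Hilbert series `1`. -/
theorem hilbertSeries_top_of_isEmpty :
    hilbertSeries (⊤ : Submodule K (MvPolynomial (Fin 0) K)) = 1 := by
  ext n
  rw [coeff_hilbertSeries, PowerSeries.coeff_one, hilb, top_inf_eq]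
  split_ifs with hn
  · subst hn
    rw [MvPolynomial.homogeneousSubmodule_zero, Submodule.one_eq_span,
      finrank_span_singleton one_ne_zero]
    rfl
  · have : MvPolynomial.homogeneousSubmodule (Fin 0) K n = ⊥ := by
      rw [eq_bot_iff]
      intro f hf
      by_contra hne
      exact hn (MvPolynomial.IsHomogeneous.inj_right hf
        (MvPolynomial.isHomogeneous_of_isEmpty _ _ f) hne)
    rw [this, finrank_bot]
    rfl

theorem homogeneousComponent_succ_linForm_mul (x : Fin s → K) (g : MvPolynomial (Fin s) K)
    (n : ℕ) : MvPolynomial.homogeneousComponent (n + 1) (linForm x * g) =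
      linForm x * MvPolynomial.homogeneousComponent n g := by
  conv_lhs => rw [← MvPolynomial.sum_homogeneousComponent g, Finset.mul_sum, map_sum]
  have hterm (i : ℕ) : MvPolynomial.homogeneousComponent (n + 1)
      (linForm x * MvPolynomial.homogeneousComponent i g) =
      if i = n then linForm x * MvPolynomial.homogeneousComponent n g else 0 := by
    rw [MvPolynomial.homogeneousComponent_of_mem (m := n + 1) (n := 1 + i)
      ((isHomogeneous_linForm x).mul (MvPolynomial.homogeneousComponent_isHomogeneous i g))]
    by_cases hi : i = n
    · subst hi; simp [add_comm]
    · rw [if_neg (by omega), if_neg hi]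
  simp only [hterm, Finset.sum_ite_eq', Finset.mem_range]
  split_ifs with hn
  · rfl
  · rw [MvPolynomial.homogeneousComponent_eq_zero _ _ (by omega), mul_zero]

theorem homogeneousComponent_zero_linForm_mul (x : Fin s → K) (g : MvPolynomial (Fin s) K) :
    MvPolynomial.homogeneousComponent 0 (linForm x * g) = 0 := by
  rw [MvPolynomial.homogeneousComponent_zero, ← MvPolynomial.constantCoeff_eq, map_mul]
  simp [linForm]

theorem isHomogeneous_of_linForm_mul {x : Fin s → K} (hx : x ≠ 0) {g : MvPolynomial (Fin s) K}
    {n : ℕ} (h : (linForm x * g).IsHomogeneous (n + 1)) : g.IsHomogeneous n := by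
  have h1 := MvPolynomial.homogeneousComponent_of_mem (m := n + 1) (n := n + 1) h
  rw [if_pos rfl, homogeneousComponent_succ_linForm_mul] at h1
  rw [← mul_left_cancel₀ (linForm_ne_zero hx) h1]
  exact MvPolynomial.homogeneousComponent_isHomogeneous n g

theorem finrank_inf_ker_add_finrank_map {V W : Type*} [AddCommGroup V] [Module K V]
    [AddCommGroup W] [Module K W] (f : V →ₗ[K] W) (U : Submodule K V) [Module.Finite K U] :
    Module.finrank K ↥(U ⊓ LinearMap.ker f) + Module.finrank K ↥(U.map f) =
      Module.finrank K U := by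
  have h := (f.domRestrict U).finrank_range_add_finrank_ker
  have hk : LinearMap.ker (f.domRestrict U) = (LinearMap.ker f).comap U.subtype := by
    ext x; simp
  rw [LinearMap.range_domRestrict, hk] at h
  rw [← h, add_comm, ← (Submodule.comapSubtypeEquivOfLe (inf_le_left :
    U ⊓ LinearMap.ker f ≤ U)).finrank_eq, Submodule.comap_inf, Submodule.comap_subtype_self,
    top_inf_eq]

theorem finrank_map_mulLeft_linForm {z : Fin s → K} (hz : z ≠ 0)
    (V : Submodule K (MvPolynomial (Fin s) K)) :
    Module.finrank K ↥(V.map (LinearMap.mulLeft K (linForm z))) = Module.finrank K V :=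
  (Submodule.equivMapOfInjective (LinearMap.mulLeft K (linForm z))
    (fun _ _ h => mul_left_cancel₀ (linForm_ne_zero hz) h) V).finrank_eq.symm

variable {z : Fin s → K} {π : (Fin s → K) →ₗ[K] (Fin s' → K)}
  {V V₁ : Submodule K (MvPolynomial (Fin s) K)} {V₂ : Submodule K (MvPolynomial (Fin s') K)}

theorem finrank_map_linSubst_le (h₁ : ∀ f ∈ V, linSubst π f ∈ V₂) (n : ℕ) :
    Module.finrank K ↥((V ⊓ MvPolynomial.homogeneousSubmodule (Fin s) K n).map
      (linSubst π).toLinearMap) ≤ hilb V₂ n := by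
  apply Submodule.finrank_mono
  rintro _ ⟨f, ⟨hfV, hf⟩, rfl⟩
  exact ⟨h₁ f hfV, isHomogeneous_linSubst π hf⟩

/-- If substituting `π` maps `V` into `V₂` and the quotients by `p_z` of the elements of `V`
divisible by `p_z` lie in `V₁`, then `0 → V₁(-1) → V → V₂` bounds the Hilbert function of `V`. -/
theorem hilb_succ_le (hz : z ≠ 0) (hπ : Function.Surjective π)
    (hker : LinearMap.ker π = Submodule.span K {z}) (h₁ : ∀ f ∈ V, linSubst π f ∈ V₂)
    (h₂ : ∀ g, linForm z * g ∈ V → g ∈ V₁) (n : ℕ) :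
    hilb V (n + 1) ≤ hilb V₁ n + hilb V₂ (n + 1) := by
  rw [hilb, ← finrank_inf_ker_add_finrank_map (linSubst π).toLinearMap]
  refine add_le_add ?_ (finrank_map_linSubst_le h₁ _)
  rw [hilb, ← finrank_map_mulLeft_linForm hz
    (V₁ ⊓ MvPolynomial.homogeneousSubmodule (Fin s) K n)]
  apply Submodule.finrank_mono
  rintro f ⟨⟨hfV, hf⟩, hf0⟩
  obtain ⟨g, rfl⟩ := linForm_dvd_of_linSubst_eq_zero hπ hker hf0
  exact ⟨g, ⟨h₂ g hfV, isHomogeneous_of_linForm_mul hz hf⟩, rfl⟩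

theorem hilb_zero_le (hπ : Function.Surjective π)
    (hker : LinearMap.ker π = Submodule.span K {z}) (h₁ : ∀ f ∈ V, linSubst π f ∈ V₂) :
    hilb V 0 ≤ hilb V₂ 0 := by
  rw [hilb, ← finrank_inf_ker_add_finrank_map (linSubst π).toLinearMap]
  have h0 : V ⊓ MvPolynomial.homogeneousSubmodule (Fin s) K 0 ⊓
      LinearMap.ker (linSubst π).toLinearMap = ⊥ := by
    rw [eq_bot_iff]
    rintro f ⟨⟨-, hf⟩, hf0⟩
    obtain ⟨g, rfl⟩ := linForm_dvd_of_linSubst_eq_zero hπ hker hf0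
    have := MvPolynomial.homogeneousComponent_of_mem (m := 0) (n := 0) hf
    rw [if_pos rfl, homogeneousComponent_zero_linForm_mul] at this
    exact this.symm
  rw [h0, finrank_bot, zero_add]
  exact finrank_map_linSubst_le h₁ _

theorem le_finrank_map_linSubst
    (hV : ∀ f ∈ V, ∀ n, MvPolynomial.homogeneousComponent n f ∈ V)
    (h₁ : V₂ ≤ V.map (linSubst π).toLinearMap) (n : ℕ) :
    hilb V₂ n ≤ Module.finrank K ↥((V ⊓ MvPolynomial.homogeneousSubmodule (Fin s) K n).map
      (linSubst π).toLinearMap) := by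
  apply Submodule.finrank_mono
  rintro g ⟨hgV, hg⟩
  obtain ⟨f, hf, rfl⟩ := h₁ hgV
  refine ⟨MvPolynomial.homogeneousComponent n f,
    ⟨hV f hf n, MvPolynomial.homogeneousComponent_isHomogeneous n f⟩, ?_⟩
  have hterm (i : ℕ) : MvPolynomial.homogeneousComponent n
      (linSubst π (MvPolynomial.homogeneousComponent i f)) =
      if i = n then linSubst π (MvPolynomial.homogeneousComponent n f) else 0 := by
    rw [MvPolynomial.homogeneousComponent_of_mem (m := n) (n := i)
      (isHomogeneous_linSubst π (MvPolynomial.homogeneousComponent_isHomogeneous i f))]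
    by_cases hi : i = n
    · subst hi; simp
    · rw [if_neg (Ne.symm hi), if_neg hi]
  have h := MvPolynomial.homogeneousComponent_of_mem (m := n) (n := n) hg
  rw [if_pos rfl] at h
  rw [← h]
  simp only [AlgHom.toLinearMap_apply]
  conv_rhs => rw [← MvPolynomial.sum_homogeneousComponent f, map_sum, map_sum]
  simp only [hterm, Finset.sum_ite_eq', Finset.mem_range]
  split_ifs with hn
  · rfl
  · rw [MvPolynomial.homogeneousComponent_eq_zero _ _ (by omega), map_zero]

/-- The reverse bound, when `p_z V₁ ⊆ V`, every element of `V₂` lifts to `V`, and `V` is graded. -/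
theorem le_hilb_succ (hz : z ≠ 0) (hπz : π z = 0)
    (hV : ∀ f ∈ V, ∀ n, MvPolynomial.homogeneousComponent n f ∈ V)
    (h₁ : V₂ ≤ V.map (linSubst π).toLinearMap)
    (h₂ : ∀ g ∈ V₁, linForm z * g ∈ V) (n : ℕ) :
    hilb V₁ n + hilb V₂ (n + 1) ≤ hilb V (n + 1) := by
  rw [hilb.eq_def V, ← finrank_inf_ker_add_finrank_map (linSubst π).toLinearMap]
  refine add_le_add ?_ (le_finrank_map_linSubst hV h₁ _)
  rw [hilb, ← finrank_map_mulLeft_linForm hz]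
  apply Submodule.finrank_mono
  rintro _ ⟨g, ⟨hgV, hg⟩, rfl⟩
  refine ⟨⟨h₂ g hgV, ?_⟩, ?_⟩
  · have := (isHomogeneous_linForm z).mul hg
    rwa [add_comm] at this
  · simp [hπz]

theorem le_hilb_zero (hV : ∀ f ∈ V, ∀ n, MvPolynomial.homogeneousComponent n f ∈ V)
    (h₁ : V₂ ≤ V.map (linSubst π).toLinearMap) : hilb V₂ 0 ≤ hilb V 0 :=
  (le_finrank_map_linSubst hV h₁ 0).trans (Submodule.finrank_map_le _ _)

end GradedPieces

/-! ### Central spaces as spaces of polynomials with bounded directional degrees -/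

section PowerSpaces

variable {K : Type*} [Field K] {s s' : ℕ} {ι : Type*}

open scoped Classical in
/-- The number of vectors `Z i`, `i ∈ A`, off the hyperplane `h = 0`. -/
noncomputable def offCount (Z : ι → Fin s → K) (A : Finset ι) (h : (Fin s → K) →ₗ[K] K) : ℕ :=
  (A.filter fun i => h (Z i) ≠ 0).card

/-- The polynomials whose degree in each direction `h ≠ 0` is less than the number of vectors of the
list off the hyperplane `h = 0`, minus `k`. The list is `(Z i)_{i ∈ A}`. Since the difference
is truncated, a direction with at most `k` vectors off its hyperplane forces the space to be
zero. -/
noncomputable def powerSpace (k : ℕ) (Z : ι → Fin s → K) (A : Finset ι) :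
    Submodule K (MvPolynomial (Fin s) K) where
  carrier := {f | ∀ h : (Fin s → K) →ₗ[K] K, h ≠ 0 →
    (dirShift h f).degree < ((offCount Z A h - k : ℕ) : WithBot ℕ)}
  zero_mem' h _ := by simp
  add_mem' {f g} hf hg h hh := by
    rw [map_add]
    exact (Polynomial.degree_add_le _ _).trans_lt (max_lt (hf h hh) (hg h hh))
  smul_mem' c f hf h hh := by
    rw [map_smul]
    exact (Polynomial.degree_smul_le _ _).trans_lt (hf h hh)

theorem mem_powerSpace {k : ℕ} {Z : ι → Fin s → K} {A : Finset ι} {f : MvPolynomial (Fin s) K} :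
    f ∈ powerSpace k Z A ↔ ∀ h : (Fin s → K) →ₗ[K] K, h ≠ 0 →
      (dirShift h f).degree < ((offCount Z A h - k : ℕ) : WithBot ℕ) := Iff.rfl

/-- The central space of the sublist `(Z i)_{i ∈ A}`. -/
noncomputable def centralOn (Z : ι → Fin s → K) (A : Finset ι) :
    Submodule K (MvPolynomial (Fin s) K) :=
  Submodule.span K {p | ∃ Y ⊆ A, Submodule.span K (Z '' {i | i ∈ A ∧ i ∉ Y}) = ⊤ ∧
    p = ∏ i ∈ Y, linForm (Z i)}

theorem offCount_comp (Z : ι → Fin s → K) (A : Finset ι) (π : (Fin s → K) →ₗ[K] (Fin s' → K))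
    (h : (Fin s' → K) →ₗ[K] K) : offCount (π ∘ Z) A h = offCount Z A (h ∘ₗ π) := rfl

theorem offCount_erase_of_eq_zero [DecidableEq ι] {Z : ι → Fin s → K} (A : Finset ι) {i : ι}
    {h : (Fin s → K) →ₗ[K] K} (hi : h (Z i) = 0) :
    offCount Z (A.erase i) h = offCount Z A h := by
  classical
  rw [offCount, offCount, ← Finset.erase_eq_of_notMem (a := i)
    (s := A.filter fun i => h (Z i) ≠ 0) (by simp [hi]), Finset.filter_erase]

theorem offCount_erase_add_one [DecidableEq ι] {Z : ι → Fin s → K} {A : Finset ι} {i : ι}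
    (hiA : i ∈ A) {h : (Fin s → K) →ₗ[K] K} (hi : h (Z i) ≠ 0) :
    offCount Z (A.erase i) h + 1 = offCount Z A h := by
  classical
  rw [offCount, offCount, Finset.filter_erase, Finset.card_erase_add_one (by simp [hiA, hi])]

theorem offCount_sdiff_add [DecidableEq ι] (Z : ι → Fin s → K) {A Y : Finset ι} (hY : Y ⊆ A)
    (h : (Fin s → K) →ₗ[K] K) : offCount Z (A \ Y) h + offCount Z Y h = offCount Z A h := by
  classical
  rw [offCount, offCount, offCount, ← Finset.card_union_of_disjoint, ← Finset.filter_union,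
    Finset.sdiff_union_of_subset hY]
  exact Finset.disjoint_filter_filter Finset.sdiff_disjoint

/-- If the vectors of a list span, every nonzero functional is nonzero on one of them. -/
theorem exists_ne_zero_of_span_eq_top {Z : ι → Fin s → K} {S : Set ι}
    (hS : Submodule.span K (Z '' S) = ⊤) {h : (Fin s → K) →ₗ[K] K} (hh : h ≠ 0) :
    ∃ i ∈ S, h (Z i) ≠ 0 := by
  by_contra! hcon
  apply hh
  rw [← LinearMap.ker_eq_top, eq_top_iff, ← hS, Submodule.span_le]
  rintro _ ⟨i, hi, rfl⟩
  exact hcon i hi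

theorem degree_dirShift_prod_le (Z : ι → Fin s → K) (Y : Finset ι) (h : (Fin s → K) →ₗ[K] K) :
    (dirShift h (∏ i ∈ Y, linForm (Z i))).degree ≤ (offCount Z Y h : WithBot ℕ) := by
  classical
  rw [map_prod, Polynomial.degree_prod, offCount, Finset.card_filter, Nat.cast_sum]
  refine Finset.sum_le_sum fun i _ => ?_
  split_ifs with hi
  · simp [degree_dirShift_linForm hi]
  · rw [not_not] at hi
    rw [dirShift_linForm_of_eq_zero hi]
    exact Polynomial.degree_C_le

/-- If the vectors of any spanning sublist of `(Z i)_{i ∈ A}` include more than `k` vectors off the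
hyperplane `h = 0`, then the polynomials of the central space have small degree in direction `h`. -/
theorem degree_dirShift_lt_of_mem_centralOn [DecidableEq ι] {Z : ι → Fin s → K} {A : Finset ι}
    {h : (Fin s → K) →ₗ[K] K} {k : ℕ}
    (hk : ∀ B : Finset ι, Submodule.span K (Z '' B) = ⊤ → k < offCount Z B h)
    {f : MvPolynomial (Fin s) K} (hf : f ∈ centralOn Z A) :
    (dirShift h f).degree < ((offCount Z A h - k : ℕ) : WithBot ℕ) := by
  induction hf using Submodule.span_induction with
  | mem f hf =>
    obtain ⟨Y, hY, hspan, rfl⟩ := hf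
    refine (degree_dirShift_prod_le Z Y h).trans_lt ?_
    have h1 := hk (A \ Y) (by convert hspan using 3; ext; simp)
    have h2 := offCount_sdiff_add Z hY h
    exact_mod_cast (by omega : offCount Z Y h < offCount Z A h - k)
  | zero => simp
  | add f g _ _ hf hg =>
    rw [map_add]
    exact (Polynomial.degree_add_le _ _).trans_lt (max_lt hf hg)
  | smul c f _ hf =>
    rw [map_smul]
    exact (Polynomial.degree_smul_le _ _).trans_lt hf

theorem offCount_pos {Z : ι → Fin s → K} {B : Finset ι}
    (hB : Submodule.span K (Z '' B) = ⊤) {h : (Fin s → K) →ₗ[K] K} (hh : h ≠ 0) :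
    0 < offCount Z B h := by
  classical
  obtain ⟨i, hi, hne⟩ := exists_ne_zero_of_span_eq_top hB hh
  exact Finset.card_pos.2 ⟨i, by simpa using ⟨hi, hne⟩⟩

theorem centralOn_le_powerSpace [DecidableEq ι] (Z : ι → Fin s → K) (A : Finset ι) :
    centralOn Z A ≤ powerSpace 0 Z A :=
  fun _ hf _ hh => degree_dirShift_lt_of_mem_centralOn (fun _ hB => offCount_pos hB hh) hf

theorem centralOn_eq_bot {Z : ι → Fin s → K} {A : Finset ι}
    (hA : Submodule.span K (Z '' A) ≠ ⊤) : centralOn Z A = ⊥ := by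
  rw [centralOn, Submodule.span_eq_bot]
  rintro _ ⟨Y, -, hY, -⟩
  refine absurd (top_le_iff.1 (hY.ge.trans (Submodule.span_mono (Set.image_mono ?_)))) hA
  exact fun i hi => hi.1

theorem homogeneousComponent_mem_centralOn {Z : ι → Fin s → K} {A : Finset ι}
    {f : MvPolynomial (Fin s) K} (hf : f ∈ centralOn Z A) (n : ℕ) :
    MvPolynomial.homogeneousComponent n f ∈ centralOn Z A := by
  induction hf using Submodule.span_induction with
  | mem f hf =>
    have hf' := hf
    obtain ⟨Y, hY, hspan, rfl⟩ := hf'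
    have : (∏ i ∈ Y, linForm (Z i)).IsHomogeneous (∑ i ∈ Y, 1) :=
      MvPolynomial.IsHomogeneous.prod _ _ _ fun i _ => isHomogeneous_linForm _
    rw [MvPolynomial.homogeneousComponent_of_mem this]
    split_ifs
    · exact Submodule.subset_span hf
    · exact Submodule.zero_mem _
  | zero => simp
  | add f g _ _ hf hg => rw [map_add]; exact Submodule.add_mem _ hf hg
  | smul c f _ hf => rw [map_smul]; exact Submodule.smul_mem _ c hf

theorem linForm_mul_mem_centralOn [DecidableEq ι] {Z : ι → Fin s → K} {A : Finset ι} {i : ι}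
    (hi : i ∈ A) {g : MvPolynomial (Fin s) K} (hg : g ∈ centralOn Z (A.erase i)) :
    linForm (Z i) * g ∈ centralOn Z A := by
  induction hg using Submodule.span_induction with
  | mem f hf =>
    obtain ⟨Y, hY, hspan, rfl⟩ := hf
    have hiY : i ∉ Y := fun h => by simpa using hY h
    refine Submodule.subset_span ⟨insert i Y, ?_, ?_, (Finset.prod_insert hiY).symm⟩
    · exact Finset.insert_subset hi (hY.trans (Finset.erase_subset _ _))
    · rw [← hspan]
      congr 2
      ext j
      simp only [Set.mem_ofPred_eq, Finset.mem_insert, Finset.mem_erase]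
      tauto
  | zero => simp
  | add f g _ _ hf hg => rw [mul_add]; exact Submodule.add_mem _ hf hg
  | smul c f _ hf => rw [mul_smul_comm]; exact Submodule.smul_mem _ c hf

variable {π : (Fin s → K) →ₗ[K] (Fin s' → K)}

theorem span_image_comp (π : (Fin s → K) →ₗ[K] (Fin s' → K)) (Z : ι → Fin s → K) (S : Set ι) :
    Submodule.span K ((π ∘ Z) '' S) = (Submodule.span K (Z '' S)).map π := by
  rw [Set.image_comp, Submodule.span_image]

theorem span_image_comp_eq_top_iff {Z : ι → Fin s → K} (hπ : Function.Surjective π)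
    {v : Fin s → K} (hker : LinearMap.ker π = Submodule.span K {v}) {S : Set ι}
    (hv : v ∈ Submodule.span K (Z '' S)) :
    Submodule.span K ((π ∘ Z) '' S) = ⊤ ↔ Submodule.span K (Z '' S) = ⊤ := by
  rw [span_image_comp]
  constructor
  · intro h
    have h1 := congrArg (Submodule.comap π) h
    rwa [Submodule.comap_map_eq, Submodule.comap_top, hker,
      sup_eq_left.2 ((Submodule.span_singleton_le_iff_mem _ _).2 hv)] at h1
  · intro h
    rw [h, Submodule.map_top, LinearMap.range_eq_top.2 hπ]

theorem span_image_comp_erase [DecidableEq ι] {Z : ι → Fin s → K} {i : ι} (hi : π (Z i) = 0)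
    (B : Finset ι) : Submodule.span K ((π ∘ Z) '' (B.erase i)) =
      Submodule.span K ((π ∘ Z) '' B) := by
  refine le_antisymm (Submodule.span_mono (Set.image_mono (by simp))) (Submodule.span_le.2 ?_)
  rintro _ ⟨j, hj, rfl⟩
  by_cases hji : j = i
  · subst hji
    simp [hi]
  · exact Submodule.subset_span ⟨j, by simpa [hji] using hj, rfl⟩

/-- Products of linear forms over `Y ∌ i` lift from the quotient by `Z i`, so the central space of
the contraction lifts to the central space. -/
theorem centralOn_comp_le_map [DecidableEq ι] {Z : ι → Fin s → K} {A : Finset ι} {i : ι}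
    (hi : i ∈ A) (hπ : Function.Surjective π)
    (hker : LinearMap.ker π = Submodule.span K {Z i}) :
    centralOn (π ∘ Z) (A.erase i) ≤ (centralOn Z A).map (linSubst π).toLinearMap := by
  refine Submodule.span_le.2 ?_
  rintro _ ⟨Y, hY, hspan, rfl⟩
  have hiY : i ∉ Y := fun h => by simpa using hY h
  refine ⟨∏ j ∈ Y, linForm (Z j), Submodule.subset_span
    ⟨Y, hY.trans (Finset.erase_subset _ _), ?_, rfl⟩, by simp⟩
  have hmem : Z i ∈ Submodule.span K (Z '' {j | j ∈ A ∧ j ∉ Y}) :=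
    Submodule.subset_span (Set.mem_image_of_mem Z ⟨hi, hiY⟩)
  rw [← span_image_comp_eq_top_iff hπ hker hmem,
    ← top_le_iff, ← hspan]
  refine Submodule.span_mono (Set.image_mono ?_)
  rintro j ⟨hj, hjY⟩
  exact ⟨Finset.mem_of_mem_erase hj, hjY⟩

theorem comp_ne_zero (hπ : Function.Surjective π) {h : (Fin s' → K) →ₗ[K] K} (hh : h ≠ 0) :
    h ∘ₗ π ≠ 0 := by
  intro h0
  exact hh (LinearMap.ext fun y => by
    obtain ⟨x, rfl⟩ := hπ y
    exact LinearMap.congr_fun h0 x)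

theorem linSubst_mem_powerSpace [DecidableEq ι] {k : ℕ} {Z : ι → Fin s → K} {A : Finset ι} {i : ι}
    (hπ : Function.Surjective π) (hi : π (Z i) = 0)
    {f : MvPolynomial (Fin s) K} (hf : f ∈ powerSpace k Z A) :
    linSubst π f ∈ powerSpace k (π ∘ Z) (A.erase i) := by
  intro h hh
  rw [offCount_erase_of_eq_zero A (by simp [hi]), offCount_comp]
  exact (degree_dirShift_linSubst_le π h f).trans_lt (hf _ (comp_ne_zero hπ hh))

theorem mem_powerSpace_erase [DecidableEq ι] {k : ℕ} {Z : ι → Fin s → K} {A : Finset ι} {i : ι}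
    (hi : i ∈ A) (hz : Z i ≠ 0) {g : MvPolynomial (Fin s) K}
    (hg : linForm (Z i) * g ∈ powerSpace k Z A) : g ∈ powerSpace k Z (A.erase i) := by
  intro h hh
  have := hg h hh
  by_cases hhz : h (Z i) = 0
  · rwa [degree_dirShift_linForm_mul_of_eq_zero hz hhz, ← offCount_erase_of_eq_zero A hhz] at this
  · rw [degree_dirShift_linForm_mul hhz, ← offCount_erase_add_one hi hhz] at this
    by_cases hg0 : dirShift h g = 0
    · simp [hg0]
    · rw [Polynomial.degree_eq_natDegree hg0] at this ⊢
      have h1 : (dirShift h g).natDegree + 1 < offCount Z (A.erase i) h + 1 - k := by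
        exact_mod_cast this
      exact_mod_cast (by omega : (dirShift h g).natDegree < offCount Z (A.erase i) h - k)

theorem powerSpace_eq_bot {k : ℕ} {Z : ι → Fin s → K} {A : Finset ι} {h : (Fin s → K) →ₗ[K] K}
    (hh : h ≠ 0) (hk : offCount Z A h ≤ k) : powerSpace k Z A = ⊥ := by
  rw [eq_bot_iff]
  intro f hf
  have := hf h hh
  rw [Nat.sub_eq_zero_of_le hk, Nat.cast_zero, Nat.WithBot.lt_zero_iff,
    Polynomial.degree_eq_bot] at this
  exact (map_eq_zero_iff _ (dirShift_injective h)).1 this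

theorem powerSpace_eq_top_of_isEmpty (k : ℕ) (Z : ι → Fin 0 → K) (A : Finset ι) :
    powerSpace k Z A = ⊤ := by
  rw [eq_top_iff]
  intro f _ h hh
  exact absurd (Subsingleton.elim h 0) hh

theorem centralOn_eq_top_of_isEmpty (Z : ι → Fin 0 → K) (A : Finset ι) : centralOn Z A = ⊤ := by
  rw [eq_top_iff]
  intro f _
  obtain ⟨c, rfl⟩ := MvPolynomial.C_surjective (Fin 0) f
  rw [← mul_one (MvPolynomial.C c), ← MvPolynomial.smul_eq_C_mul]
  refine Submodule.smul_mem _ c (Submodule.subset_span ⟨∅, by simp, Subsingleton.elim _ _, by simp⟩)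

theorem powerSpace_zero_eq_centralOn_of_forall_eq_zero {Z : ι → Fin s → K} {A : Finset ι}
    (hA : ∀ i ∈ A, Z i = 0) : powerSpace 0 Z A = centralOn Z A := by
  classical
  cases s with
  | zero => rw [powerSpace_eq_top_of_isEmpty, centralOn_eq_top_of_isEmpty]
  | succ s =>
    have hh : (LinearMap.proj 0 : (Fin (s + 1) → K) →ₗ[K] K) ≠ 0 := fun h => by
      simpa using LinearMap.congr_fun h (Pi.single 0 1)
    have h0 : powerSpace 0 Z A = ⊥ := powerSpace_eq_bot hh (by
      rw [offCount, Nat.le_zero, Finset.card_eq_zero, Finset.filter_eq_empty_iff]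
      intro i hi
      simp [hA i hi])
    rw [h0, eq_comm, eq_bot_iff, ← h0]
    exact centralOn_le_powerSpace Z A

/-- The central space consists of all polynomials whose degree in every direction is less than the
number of vectors off the corresponding hyperplane. By deletion and contraction of a nonzero vector
`Z i`: lift the image of `f` modulo `p_{Z i}` to the central space; the difference
is `p_{Z i}` times an element of the central space of the deletion. -/
theorem powerSpace_zero_eq_centralOn [DecidableEq ι] (Z : ι → Fin s → K) (A : Finset ι) :
    powerSpace 0 Z A = centralOn Z A := by
  induction hn : A.card generalizing s A with
  | zero =>
    rw [Finset.card_eq_zero] at hn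
    exact powerSpace_zero_eq_centralOn_of_forall_eq_zero (by simp [hn])
  | succ n ih =>
    by_cases hA : ∀ i ∈ A, Z i = 0
    · exact powerSpace_zero_eq_centralOn_of_forall_eq_zero hA
    push Not at hA
    obtain ⟨i, hi, hz⟩ := hA
    have hcard : (A.erase i).card = n := by rw [Finset.card_erase_of_mem hi, hn]; rfl
    obtain _ | s := s
    · exact absurd (Subsingleton.elim _ _) hz
    obtain ⟨π, hπ, hker⟩ := exists_surjective_ker_eq_span_singleton hz
    have hπz : π (Z i) = 0 := by
      rw [← LinearMap.mem_ker, hker]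
      exact Submodule.mem_span_singleton_self _
    refine le_antisymm (fun f hf => ?_) (centralOn_le_powerSpace Z A)
    have h1 := linSubst_mem_powerSpace hπ hπz hf
    rw [ih (π ∘ Z) _ hcard] at h1
    obtain ⟨g, hg, hgf⟩ := centralOn_comp_le_map hi hπ hker h1
    obtain ⟨k, hk⟩ := linForm_dvd_of_linSubst_eq_zero hπ hker (f := f - g)
      (by rw [map_sub, sub_eq_zero]; exact hgf.symm)
    have h2 : linForm (Z i) * k ∈ powerSpace 0 Z A := by
      rw [← hk]
      exact Submodule.sub_mem _ hf (centralOn_le_powerSpace Z A hg)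
    have h3 := mem_powerSpace_erase hi hz h2
    rw [ih Z _ hcard] at h3
    have h4 := linForm_mul_mem_centralOn hi h3
    rw [← hk] at h4
    simpa using Submodule.add_mem _ h4 hg

/-! ### The exact sequences of deletion and contraction -/

theorem hilb_powerSpace_succ_le [DecidableEq ι] (k : ℕ) {Z : ι → Fin s → K} {A : Finset ι} {i : ι}
    (hi : i ∈ A) (hz : Z i ≠ 0) (hπ : Function.Surjective π)
    (hker : LinearMap.ker π = Submodule.span K {Z i}) (n : ℕ) :
    hilb (powerSpace k Z A) (n + 1) ≤
      hilb (powerSpace k Z (A.erase i)) n + hilb (powerSpace k (π ∘ Z) (A.erase i)) (n + 1) := by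
  have hπz : π (Z i) = 0 := by
    rw [← LinearMap.mem_ker, hker]
    exact Submodule.mem_span_singleton_self _
  exact hilb_succ_le hz hπ hker (fun f hf => linSubst_mem_powerSpace hπ hπz hf)
    (fun g hg => mem_powerSpace_erase hi hz hg) n

theorem hilb_powerSpace_zero_le [DecidableEq ι] (k : ℕ) {Z : ι → Fin s → K} {A : Finset ι} {i : ι}
    (hπ : Function.Surjective π) (hker : LinearMap.ker π = Submodule.span K {Z i}) :
    hilb (powerSpace k Z A) 0 ≤ hilb (powerSpace k (π ∘ Z) (A.erase i)) 0 := by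
  have hπz : π (Z i) = 0 := by
    rw [← LinearMap.mem_ker, hker]
    exact Submodule.mem_span_singleton_self _
  exact hilb_zero_le hπ hker (fun f hf => linSubst_mem_powerSpace hπ hπz hf)

theorem hilbertSeries_centralOn [DecidableEq ι] {Z : ι → Fin s → K} {A : Finset ι} {i : ι}
    (hi : i ∈ A) (hz : Z i ≠ 0) (hπ : Function.Surjective π)
    (hker : LinearMap.ker π = Submodule.span K {Z i}) :
    hilbertSeries (centralOn Z A) =
      PowerSeries.X * hilbertSeries (centralOn Z (A.erase i)) +
        hilbertSeries (centralOn (π ∘ Z) (A.erase i)) := by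
  have hπz : π (Z i) = 0 := by
    rw [← LinearMap.mem_ker, hker]
    exact Submodule.mem_span_singleton_self _
  have hgr : ∀ f ∈ centralOn Z A, ∀ n, MvPolynomial.homogeneousComponent n f ∈ centralOn Z A :=
    fun f hf n => homogeneousComponent_mem_centralOn hf n
  have hlift := centralOn_comp_le_map hi hπ hker
  ext n
  rw [map_add]
  cases n with
  | zero =>
    rw [PowerSeries.coeff_zero_X_mul, zero_add, coeff_hilbertSeries, coeff_hilbertSeries,
      le_antisymm _ (le_hilb_zero hgr hlift)]
    have := hilb_powerSpace_zero_le 0 (A := A) hπ hker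
    rwa [powerSpace_zero_eq_centralOn, powerSpace_zero_eq_centralOn] at this
  | succ n =>
    rw [PowerSeries.coeff_succ_X_mul, coeff_hilbertSeries, coeff_hilbertSeries,
      coeff_hilbertSeries, le_antisymm _ (le_hilb_succ hz hπz hgr hlift
        (fun g hg => linForm_mul_mem_centralOn hi hg) n), Nat.cast_add]
    have := hilb_powerSpace_succ_le 0 hi hz hπ hker n
    rwa [powerSpace_zero_eq_centralOn, powerSpace_zero_eq_centralOn,
      powerSpace_zero_eq_centralOn] at this

/-! ### Quotients by a generic vector -/

/-- Over an infinite field there is a vector outside all proper subspaces spanned by sublists. -/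
theorem exists_forall_notMem_span [Infinite K] [Finite ι] (Z : ι → Fin s → K) :
    ∃ v : Fin s → K, ∀ S : Set ι, Submodule.span K (Z '' S) ≠ ⊤ →
      v ∉ Submodule.span K (Z '' S) := by
  by_contra! hcon
  let p : {S : Set ι // Submodule.span K (Z '' S) ≠ ⊤} → Subspace K (Fin s → K) :=
    fun S => Submodule.span K (Z '' S.1)
  obtain ⟨S, hS⟩ := Subspace.exists_eq_top_of_iUnion_eq_univ (p := p) (by
    rw [Set.eq_univ_iff_forall]
    intro v
    obtain ⟨S, hS, hv⟩ := hcon v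
    exact Set.mem_iUnion.2 ⟨⟨S, hS⟩, hv⟩)
  exact S.2 hS

/-- A hyperplane `h = 0` through a generic vector `v` is not spanned by vectors of the list, so a
spanning sublist has at least two vectors off it. -/
theorem one_lt_offCount [DecidableEq ι] {Z : ι → Fin s → K} {v : Fin s → K}
    (hv : ∀ S : Set ι, Submodule.span K (Z '' S) ≠ ⊤ → v ∉ Submodule.span K (Z '' S))
    {B : Finset ι} (hB : Submodule.span K (Z '' B) = ⊤) {h : (Fin s → K) →ₗ[K] K} (hh : h ≠ 0)
    (hhv : h v = 0) : 1 < offCount Z B h := by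
  classical
  obtain ⟨i, hi, hne⟩ := exists_ne_zero_of_span_eq_top hB hh
  rw [← offCount_erase_add_one hi hne]
  have hker : LinearMap.ker h ≠ ⊤ := fun h0 => hh (LinearMap.ker_eq_top.1 h0)
  by_contra hcon
  -- All vectors of the sublist other than `Z i` lie in the kernel of `h`.
  have h0 : ∀ j ∈ B, j ≠ i → h (Z j) = 0 := by
    have : offCount Z (B.erase i) h = 0 := by omega
    rw [offCount, Finset.card_eq_zero, Finset.filter_eq_empty_iff] at this
    intro j hj hji
    simpa using this (Finset.mem_erase.2 ⟨hji, hj⟩)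
  have hle : Submodule.span K (Z '' (B.erase i)) ≤ LinearMap.ker h := by
    rw [Submodule.span_le]
    rintro _ ⟨j, hj, rfl⟩
    simp only [Finset.coe_erase, Set.mem_sdiff, Set.mem_singleton_iff] at hj
    exact h0 j hj.1 hj.2
  have hmem : v ∈ Submodule.span K (insert (Z i) (Z '' (B.erase i))) := by
    rw [← Set.image_insert_eq, ← Finset.coe_insert, Finset.insert_erase hi, hB]
    trivial
  obtain ⟨c, w, hw, rfl⟩ := Submodule.mem_span_insert.1 hmem
  have hc : c = 0 := by
    have := hle hw
    rw [LinearMap.mem_ker] at this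
    simpa [this, hne] using hhv
  rw [hc, zero_smul, zero_add] at hv
  refine hv _ (fun h1 => hker (top_le_iff.1 (h1 ▸ hle))) hw

theorem linSubst_mem_powerSpace_one [DecidableEq ι] {Z : ι → Fin s → K} {A : Finset ι}
    {v : Fin s → K} (hv : ∀ S : Set ι, Submodule.span K (Z '' S) ≠ ⊤ →
      v ∉ Submodule.span K (Z '' S)) (hπ : Function.Surjective π) (hπv : π v = 0)
    {f : MvPolynomial (Fin s) K} (hf : f ∈ centralOn Z A) :
    linSubst π f ∈ powerSpace 1 (π ∘ Z) A := by
  intro h hh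
  rw [offCount_comp]
  refine (degree_dirShift_linSubst_le π h f).trans_lt
    (degree_dirShift_lt_of_mem_centralOn (fun B hB => ?_) hf)
  exact one_lt_offCount hv hB (comp_ne_zero hπ hh) (by simp [hπv])

/-- If `p_v f` is in the central space for a generic vector `v`, then `f` is in the power space
that describes the internal space. -/
theorem mem_powerSpace_one_of_linForm_mul_mem [DecidableEq ι] {Z : ι → Fin s → K} {A : Finset ι}
    {v : Fin s → K} (hv : ∀ S : Set ι, Submodule.span K (Z '' S) ≠ ⊤ →
      v ∉ Submodule.span K (Z '' S)) (hv0 : v ≠ 0) {f : MvPolynomial (Fin s) K}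
    (hf : linForm v * f ∈ centralOn Z A) : f ∈ powerSpace 1 Z A := by
  intro h hh
  by_cases hhv : h v = 0
  · have := degree_dirShift_lt_of_mem_centralOn
      (fun B hB => one_lt_offCount hv hB hh hhv) hf
    rwa [degree_dirShift_linForm_mul_of_eq_zero hv0 hhv] at this
  · have := centralOn_le_powerSpace Z A hf h hh
    rw [degree_dirShift_linForm_mul hhv] at this
    by_cases hf0 : dirShift h f = 0
    · simp [hf0]
    · rw [Polynomial.degree_eq_natDegree hf0] at this ⊢
      have h1 : (dirShift h f).natDegree + 1 < offCount Z A h - 0 := by exact_mod_cast this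
      exact_mod_cast (by omega : (dirShift h f).natDegree < offCount Z A h - 1)

end PowerSpaces

/-! ### Ranks of sublists -/

section Ranks

variable {K : Type*} [Field K] {s s' : ℕ} {ι : Type*}

/-- The rank of the sublist `(Z i)_{i ∈ B}`. -/
noncomputable def rankOn (Z : ι → Fin s → K) (B : Finset ι) : ℕ :=
  Module.finrank K (Submodule.span K (Z '' B))

theorem rankOn_eq_iff {Z : ι → Fin s → K} {B : Finset ι} :
    rankOn Z B = s ↔ Submodule.span K (Z '' B) = ⊤ := by
  constructor
  · intro h
    exact Submodule.eq_top_of_finrank_eq (by rw [Module.finrank_fin_fun]; exact h)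
  · intro h
    rw [rankOn, h, finrank_top, Module.finrank_fin_fun]

theorem rankOn_le (Z : ι → Fin s → K) (A : Finset ι) : rankOn Z A ≤ s :=
  (Submodule.finrank_le _).trans_eq (Module.finrank_fin_fun K)

theorem rankOn_le_card (Z : ι → Fin s → K) (B : Finset ι) : rankOn Z B ≤ B.card := by
  classical
  rw [rankOn, ← Finset.coe_image]
  exact (finrank_span_finset_le_card _).trans Finset.card_image_le

variable {π : (Fin s → K) →ₗ[K] (Fin s' → K)} {v : Fin s → K}

theorem rankOn_comp_of_notMem (hker : LinearMap.ker π = Submodule.span K {v})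
    {Z : ι → Fin s → K} {B : Finset ι} (hv : v ∉ Submodule.span K (Z '' B)) :
    rankOn (π ∘ Z) B = rankOn Z B := by
  have hv0 : v ≠ 0 := fun h => hv (h ▸ Submodule.zero_mem _)
  rw [rankOn, rankOn, span_image_comp, ← finrank_inf_ker_add_finrank_map π, hker,
    ((Submodule.disjoint_span_singleton' hv0).2 hv).eq_bot, finrank_bot, zero_add]

theorem rankOn_comp_add_one (hker : LinearMap.ker π = Submodule.span K {v}) (hv0 : v ≠ 0)
    {Z : ι → Fin s → K} {B : Finset ι} (hv : v ∈ Submodule.span K (Z '' B)) :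
    rankOn (π ∘ Z) B + 1 = rankOn Z B := by
  rw [rankOn, rankOn, span_image_comp, ← finrank_inf_ker_add_finrank_map π, hker,
    inf_eq_right.2 ((Submodule.span_singleton_le_iff_mem _ _).2 hv), finrank_span_singleton hv0,
    add_comm]

theorem rankOn_insert [DecidableEq ι] {Z : ι → Fin s → K} {i : ι} (hz : Z i ≠ 0)
    (hker : LinearMap.ker π = Submodule.span K {Z i}) {B : Finset ι} (hi : i ∉ B) :
    rankOn Z (insert i B) = rankOn (π ∘ Z) B + 1 := by
  have hπz : π (Z i) = 0 := by
    rw [← LinearMap.mem_ker, hker]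
    exact Submodule.mem_span_singleton_self _
  rw [← rankOn_comp_add_one hker hz (Submodule.subset_span ⟨i, by simp, rfl⟩), rankOn, rankOn,
    ← span_image_comp_erase hπz (insert i B), Finset.erase_insert hi]

end Ranks

/-! ### The Hilbert series of the central space -/

section Series

open Polynomial

variable {K : Type*} [Field K] {s s' : ℕ} {ι : Type*}

open scoped Classical in
/-- The polynomial `t^(|A| - s) T(1, 1/t)` of the list `(Z i)_{i ∈ A}`, as a sum over its
spanning sublists. -/
noncomputable def centralPoly (Z : ι → Fin s → K) (A : Finset ι) : ℤ[X] :=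
  ∑ B ∈ A.powerset, if rankOn Z B = s then (1 - X) ^ (B.card - s) * X ^ (A.card - B.card) else 0

/-- The polynomial `t^|A| T(0, 1/t)` of the list `(Z i)_{i ∈ A}` if the list spans; the factor
`t^s` in excess of the Hilbert series of the internal space keeps all exponents nonnegative. -/
noncomputable def internalPoly (Z : ι → Fin s → K) (A : Finset ι) : ℤ[X] :=
  ∑ B ∈ A.powerset, (-1) ^ (s + rankOn Z B) *
    ((1 - X) ^ (B.card - rankOn Z B) * X ^ (A.card - B.card + rankOn Z B))

theorem centralPoly_eq_zero {Z : ι → Fin s → K} {A : Finset ι}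
    (hA : Submodule.span K (Z '' A) ≠ ⊤) : centralPoly Z A = 0 := by
  classical
  refine Finset.sum_eq_zero fun B hB => if_neg fun h => hA ?_
  rw [rankOn_eq_iff] at h
  exact top_le_iff.1 (h.ge.trans (Submodule.span_mono
    (Set.image_mono (Finset.coe_subset.2 (Finset.mem_powerset.1 hB)))))

theorem rankOn_of_isEmpty (Z : ι → Fin 0 → K) (B : Finset ι) : rankOn Z B = 0 :=
  rankOn_eq_iff.2 (Subsingleton.elim _ _)

theorem centralPoly_of_isEmpty (Z : ι → Fin 0 → K) (A : Finset ι) : centralPoly Z A = 1 := by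
  classical
  simp [centralPoly, rankOn_of_isEmpty, Finset.sum_pow_mul_eq_add_pow]

theorem internalPoly_of_isEmpty (Z : ι → Fin 0 → K) (A : Finset ι) : internalPoly Z A = 1 := by
  classical
  simp [internalPoly, rankOn_of_isEmpty, Finset.sum_pow_mul_eq_add_pow]

theorem centralPoly_succ [DecidableEq ι] {Z : ι → Fin (s + 1) → K} {A : Finset ι} {i : ι}
    (hi : i ∈ A) (hz : Z i ≠ 0) {π : (Fin (s + 1) → K) →ₗ[K] (Fin s → K)}
    (hker : LinearMap.ker π = Submodule.span K {Z i}) :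
    centralPoly Z A = X * centralPoly Z (A.erase i) + centralPoly (π ∘ Z) (A.erase i) := by
  have hcard := Finset.card_erase_add_one hi
  have hni := Finset.notMem_erase i A
  rw [centralPoly, ← Finset.insert_erase hi, Finset.sum_powerset_insert hni,
    Finset.insert_erase hi, centralPoly, centralPoly, Finset.mul_sum]
  congr 1
  · refine Finset.sum_congr rfl fun B hB => ?_
    have hBA := Finset.card_le_card (Finset.mem_powerset.1 hB)
    rw [mul_ite, mul_zero, ← hcard, Nat.sub_add_comm hBA]
    refine if_congr Iff.rfl ?_ rfl
    ring
  · refine Finset.sum_congr rfl fun B hB => ?_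
    have hiB : i ∉ B := fun h => hni (Finset.mem_powerset.1 hB h)
    rw [rankOn_insert hz hker hiB, Finset.card_insert_of_notMem hiB, ← hcard,
      Nat.add_sub_add_right, Nat.add_sub_add_right]
    exact if_congr (by omega) rfl rfl

/-- The Hilbert series of the central space of a list with matroid `M` of rank `s` is
`t^(|A| - s) T_M(1, 1/t)`. -/
theorem hilbertSeries_centralOn_eq [DecidableEq ι] (Z : ι → Fin s → K) (A : Finset ι) :
    hilbertSeries (centralOn Z A) = (centralPoly Z A : PowerSeries ℤ) := by
  have base (s : ℕ) (Z : ι → Fin s → K) (A : Finset ι) (hA : ∀ i ∈ A, Z i = 0) :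
      hilbertSeries (centralOn Z A) = (centralPoly Z A : PowerSeries ℤ) := by
    cases s with
    | zero =>
      rw [centralOn_eq_top_of_isEmpty, hilbertSeries_top_of_isEmpty, centralPoly_of_isEmpty,
        Polynomial.coe_one]
    | succ s =>
      have hspan : Submodule.span K (Z '' A) ≠ ⊤ := by
        have h0 : Submodule.span K (Z '' A) = ⊥ := by
          rw [Submodule.span_eq_bot]
          rintro _ ⟨i, hi, rfl⟩
          exact hA i hi
        rw [h0]
        exact bot_ne_top
      rw [centralOn_eq_bot hspan, centralPoly_eq_zero hspan, hilbertSeries_bot,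
        Polynomial.coe_zero]
  induction hn : A.card generalizing s A with
  | zero =>
    rw [Finset.card_eq_zero] at hn
    exact base s Z A (by simp [hn])
  | succ n ih =>
    by_cases hA : ∀ i ∈ A, Z i = 0
    · exact base s Z A hA
    push Not at hA
    obtain ⟨i, hi, hz⟩ := hA
    have hcard : (A.erase i).card = n := by rw [Finset.card_erase_of_mem hi, hn]; rfl
    obtain _ | s := s
    · exact absurd (Subsingleton.elim _ _) hz
    obtain ⟨π, hπ, hker⟩ := exists_surjective_ker_eq_span_singleton hz
    rw [hilbertSeries_centralOn hi hz hπ hker, ih Z _ hcard, ih (π ∘ Z) _ hcard,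
      centralPoly_succ hi hz hker, Polynomial.coe_add, Polynomial.coe_mul, Polynomial.coe_X]

/-! ### The Hilbert series of the internal space -/

theorem internalPoly_succ [DecidableEq ι] {Z : ι → Fin (s + 1) → K} {A : Finset ι} {i : ι}
    (hi : i ∈ A) (hz : Z i ≠ 0) {π : (Fin (s + 1) → K) →ₗ[K] (Fin s → K)}
    (hker : LinearMap.ker π = Submodule.span K {Z i}) :
    internalPoly Z A =
      X * internalPoly Z (A.erase i) + X * internalPoly (π ∘ Z) (A.erase i) := by
  have hcard := Finset.card_erase_add_one hi
  have hni := Finset.notMem_erase i A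
  rw [internalPoly, ← Finset.insert_erase hi, Finset.sum_powerset_insert hni,
    Finset.insert_erase hi, internalPoly, internalPoly, Finset.mul_sum, Finset.mul_sum]
  refine congrArg₂ (· + ·) ?_ ?_
  · refine Finset.sum_congr rfl fun B hB => ?_
    have hBA := Finset.card_le_card (Finset.mem_powerset.1 hB)
    rw [← hcard, Nat.sub_add_comm hBA]
    generalize (A.erase i).card - B.card = a, rankOn Z B = b
    ring
  · refine Finset.sum_congr rfl fun B hB => ?_
    have hiB : i ∉ B := fun h => hni (Finset.mem_powerset.1 hB h)
    rw [rankOn_insert hz hker hiB, Finset.card_insert_of_notMem hiB, ← hcard,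
      Nat.add_sub_add_right, Nat.add_sub_add_right]
    generalize (A.erase i).card - B.card = a, rankOn (π ∘ Z) B = b
    ring

/-- A quotient that keeps all ranks changes the sign, since it lowers the ambient dimension. -/
theorem internalPoly_eq_neg {Z : ι → Fin (s + 1) → K} {A : Finset ι} {v : Fin (s + 1) → K}
    (hv : v ∉ Submodule.span K (Z '' A)) {π : (Fin (s + 1) → K) →ₗ[K] (Fin s → K)}
    (hker : LinearMap.ker π = Submodule.span K {v}) :
    internalPoly Z A = -internalPoly (π ∘ Z) A := by
  rw [internalPoly, internalPoly, ← Finset.sum_neg_distrib]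
  refine Finset.sum_congr rfl fun B hB => ?_
  have hvB : v ∉ Submodule.span K (Z '' B) := fun h => hv (Submodule.span_mono
    (Set.image_mono (Finset.coe_subset.2 (Finset.mem_powerset.1 hB))) h)
  rw [rankOn_comp_of_notMem hker hvB]
  ring

/-- The quotient by a generic vector truncates the matroid `M` to a matroid `M'`, and
`T_{M'}(0, y) = y T_M(1, y) - T_M(0, y)`. -/
theorem X_pow_mul_centralPoly {Z : ι → Fin (s + 1) → K} (A : Finset ι) {v : Fin (s + 1) → K}
    (hv : ∀ S : Set ι, Submodule.span K (Z '' S) ≠ ⊤ → v ∉ Submodule.span K (Z '' S))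
    (hv0 : v ≠ 0) {π : (Fin (s + 1) → K) →ₗ[K] (Fin s → K)}
    (hker : LinearMap.ker π = Submodule.span K {v}) :
    X ^ s * centralPoly Z A = internalPoly Z A + internalPoly (π ∘ Z) A := by
  rw [centralPoly, internalPoly, internalPoly, Finset.mul_sum, ← Finset.sum_add_distrib]
  refine Finset.sum_congr rfl fun B hB => ?_
  split_ifs with h
  · have h1 := rankOn_comp_add_one hker hv0 (B := B) (Z := Z)
      (by rw [rankOn_eq_iff.1 h]; trivial)
    have h2 : rankOn (π ∘ Z) B = s := by omega
    have h3 := rankOn_le_card Z B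
    obtain ⟨k, hk⟩ := Nat.exists_eq_add_of_le (h ▸ h3)
    rw [h, h2, hk, Nat.add_sub_cancel_left, show s + 1 + k - s = k + 1 by omega,
      ← two_mul, ← two_mul, pow_mul, pow_mul, neg_one_sq, one_pow, one_pow]
    ring
  · rw [rankOn_comp_of_notMem hker (hv _ (mt rankOn_eq_iff.2 h))]
    ring

theorem exists_dual_ne_zero_of_span_ne_top {Z : ι → Fin s → K} {S : Set ι}
    (hS : Submodule.span K (Z '' S) ≠ ⊤) :
    ∃ h : (Fin s → K) →ₗ[K] K, h ≠ 0 ∧ ∀ i ∈ S, h (Z i) = 0 := by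
  obtain ⟨h, hh, hle⟩ := Submodule.exists_le_ker_of_lt_top _ (lt_top_iff_ne_top.2 hS)
  exact ⟨h, hh, fun i hi => hle (Submodule.subset_span ⟨i, hi, rfl⟩)⟩

theorem coeff_X_pow_mul_le {f g : PowerSeries ℤ}
    (h : ∀ n, PowerSeries.coeff n f ≤ PowerSeries.coeff n g) (k n : ℕ) :
    PowerSeries.coeff n (PowerSeries.X ^ k * f) ≤ PowerSeries.coeff n (PowerSeries.X ^ k * g) := by
  rw [PowerSeries.coeff_X_pow_mul', PowerSeries.coeff_X_pow_mul']
  split_ifs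
  · exact h _
  · exact le_rfl

/-- Deletion and contraction bound the Hilbert series of the internal space from above. If `Z i` is
a coloop, the space is zero. -/
theorem coeff_hilbertSeries_powerSpace_one_le [DecidableEq ι] (Z : ι → Fin s → K) (A : Finset ι)
    (hA : Submodule.span K (Z '' A) = ⊤) (n : ℕ) :
    PowerSeries.coeff n (PowerSeries.X ^ s * hilbertSeries (powerSpace 1 Z A)) ≤
      PowerSeries.coeff n (internalPoly Z A : PowerSeries ℤ) := by
  induction hm : A.card generalizing s A n with
  | zero =>
    rw [Finset.card_eq_zero] at hm
    subst hm
    obtain _ | s := s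
    · rw [powerSpace_eq_top_of_isEmpty, hilbertSeries_top_of_isEmpty, internalPoly_of_isEmpty,
        Polynomial.coe_one, pow_zero, one_mul]
    · simp at hA
  | succ m ih =>
    obtain _ | s := s
    · rw [powerSpace_eq_top_of_isEmpty, hilbertSeries_top_of_isEmpty, internalPoly_of_isEmpty,
        Polynomial.coe_one, pow_zero, one_mul]
    obtain ⟨i, hi, hz⟩ : ∃ i ∈ A, Z i ≠ 0 := by
      by_contra! hcon
      have h0 : Submodule.span K (Z '' A) = ⊥ := by
        rw [Submodule.span_eq_bot]
        rintro _ ⟨i, hi, rfl⟩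
        exact hcon i hi
      exact bot_ne_top (h0.symm.trans hA)
    have hcard : (A.erase i).card = m := by rw [Finset.card_erase_of_mem hi, hm]; rfl
    obtain ⟨π, hπ, hker⟩ := exists_surjective_ker_eq_span_singleton hz
    have hπz : π (Z i) = 0 := by
      rw [← LinearMap.mem_ker, hker]
      exact Submodule.mem_span_singleton_self _
    by_cases hspan : Submodule.span K (Z '' (A.erase i)) = ⊤
    · have hspan' : Submodule.span K ((π ∘ Z) '' (A.erase i)) = ⊤ := by
        rw [span_image_comp, hspan, Submodule.map_top, LinearMap.range_eq_top.2 hπ]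
      have hle (j : ℕ) : PowerSeries.coeff j (hilbertSeries (powerSpace 1 Z A)) ≤
          PowerSeries.coeff j (PowerSeries.X * hilbertSeries (powerSpace 1 Z (A.erase i)) +
            hilbertSeries (powerSpace 1 (π ∘ Z) (A.erase i))) := by
        rw [map_add]
        cases j with
        | zero =>
          rw [PowerSeries.coeff_zero_X_mul, zero_add, coeff_hilbertSeries, coeff_hilbertSeries]
          exact_mod_cast hilb_powerSpace_zero_le 1 hπ hker
        | succ j =>
          rw [PowerSeries.coeff_succ_X_mul, coeff_hilbertSeries, coeff_hilbertSeries,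
            coeff_hilbertSeries]
          exact_mod_cast hilb_powerSpace_succ_le 1 hi hz hπ hker j
      refine (coeff_X_pow_mul_le hle (s + 1) n).trans ?_
      have hrw : PowerSeries.X ^ (s + 1) *
          (PowerSeries.X * hilbertSeries (powerSpace 1 Z (A.erase i)) +
            hilbertSeries (powerSpace 1 (π ∘ Z) (A.erase i))) =
          PowerSeries.X ^ 1 *
            (PowerSeries.X ^ (s + 1) * hilbertSeries (powerSpace 1 Z (A.erase i))) +
          PowerSeries.X ^ 1 *
            (PowerSeries.X ^ s * hilbertSeries (powerSpace 1 (π ∘ Z) (A.erase i))) := by ring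
      rw [hrw, internalPoly_succ hi hz hker, Polynomial.coe_add, Polynomial.coe_mul,
        Polynomial.coe_mul, Polynomial.coe_X, map_add, map_add]
      have h1 := coeff_X_pow_mul_le (fun j => ih Z _ hspan j hcard) 1 n
      have h2 := coeff_X_pow_mul_le (fun j => ih (π ∘ Z) _ hspan' j hcard) 1 n
      rw [pow_one] at h1 h2 ⊢
      exact add_le_add h1 h2
    · have hzspan : Z i ∉ Submodule.span K (Z '' (A.erase i)) := by
        intro hmem
        apply hspan
        rw [← top_le_iff, ← hA, Submodule.span_le]
        rintro _ ⟨j, hj, rfl⟩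
        by_cases hji : j = i
        · exact hji ▸ hmem
        · exact Submodule.subset_span ⟨j, Finset.mem_coe.2 (Finset.mem_erase.2 ⟨hji, hj⟩), rfl⟩
      obtain ⟨h, hh, h0⟩ := exists_dual_ne_zero_of_span_ne_top hspan
      have hoff : offCount Z A h ≤ 1 := by
        classical
        refine (Finset.card_le_card (t := {i}) fun j hj => ?_).trans_eq (Finset.card_singleton i)
        rw [Finset.mem_filter] at hj
        by_contra hji
        exact hj.2 (h0 j (Finset.mem_coe.2 (Finset.mem_erase.2 ⟨by simpa using hji, hj.1⟩)))
      rw [powerSpace_eq_bot hh hoff, hilbertSeries_bot, mul_zero, internalPoly_succ hi hz hker,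
        internalPoly_eq_neg hzspan hker]
      simp

/-- The Hilbert series of the internal space of a spanning list with matroid `M` of rank `s` is
`t^(|A| - s) T_M(0, 1/t)`. The lower bound comes from the quotient by a generic vector `v`: the
kernel of the central space modulo `p_v` is `p_v` times the internal space, and the
image lies in the internal space of the quotient, where the upper bound applies. -/
theorem X_pow_mul_hilbertSeries_powerSpace_one [DecidableEq ι] [Infinite K] [Finite ι]
    (Z : ι → Fin s → K) (A : Finset ι) (hA : Submodule.span K (Z '' A) = ⊤) :
    PowerSeries.X ^ s * hilbertSeries (powerSpace 1 Z A) =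
      (internalPoly Z A : PowerSeries ℤ) := by
  obtain _ | s := s
  · rw [powerSpace_eq_top_of_isEmpty, hilbertSeries_top_of_isEmpty, internalPoly_of_isEmpty,
      Polynomial.coe_one, pow_zero, one_mul]
  ext n
  refine le_antisymm (coeff_hilbertSeries_powerSpace_one_le Z A hA n) ?_
  obtain ⟨v, hv⟩ := exists_forall_notMem_span Z
  have hv0 : v ≠ 0 := fun h => hv ∅ (by simp) (by simp [h])
  obtain ⟨π, hπ, hker⟩ := exists_surjective_ker_eq_span_singleton hv0
  have hπv : π v = 0 := by
    rw [← LinearMap.mem_ker, hker]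
    exact Submodule.mem_span_singleton_self _
  have hspan' : Submodule.span K ((π ∘ Z) '' A) = ⊤ := by
    rw [span_image_comp, hA, Submodule.map_top, LinearMap.range_eq_top.2 hπ]
  have hsub : ∀ f ∈ centralOn Z A, linSubst π f ∈ powerSpace 1 (π ∘ Z) A :=
    fun f hf => linSubst_mem_powerSpace_one hv hπ hπv hf
  have hle (j : ℕ) : PowerSeries.coeff j (hilbertSeries (centralOn Z A)) ≤
      PowerSeries.coeff j (PowerSeries.X * hilbertSeries (powerSpace 1 Z A) +
        hilbertSeries (powerSpace 1 (π ∘ Z) A)) := by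
    rw [map_add]
    cases j with
    | zero =>
      rw [PowerSeries.coeff_zero_X_mul, zero_add, coeff_hilbertSeries, coeff_hilbertSeries]
      exact_mod_cast hilb_zero_le hπ hker hsub
    | succ j =>
      rw [PowerSeries.coeff_succ_X_mul, coeff_hilbertSeries, coeff_hilbertSeries,
        coeff_hilbertSeries]
      exact_mod_cast hilb_succ_le hv0 hπ hker hsub
        (fun g hg => mem_powerSpace_one_of_linForm_mul_mem hv hv0 hg) j
  have h1 := coeff_X_pow_mul_le hle s n
  rw [hilbertSeries_centralOn_eq, ← Polynomial.coe_X, ← Polynomial.coe_pow, ← Polynomial.coe_mul,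
    X_pow_mul_centralPoly A hv hv0 hker, mul_add, map_add, Polynomial.coe_add, map_add,
    Polynomial.coe_pow, Polynomial.coe_X, ← mul_assoc, ← pow_succ] at h1
  have h2 := coeff_hilbertSeries_powerSpace_one_le (π ∘ Z) A hspan' n
  linarith

end Series

/-! ### Central and internal spaces of a list -/

section ListSpaces

variable {K : Type*} [Field K] {s : ℕ} {ι : Type*}

theorem finrank_image_eq_iff {Z : ι → Fin s → K} {S : Set ι} :
    (Z '' S).finrank K = s ↔ Submodule.span K (Z '' S) = ⊤ := by
  constructor
  · intro h
    exact Submodule.eq_top_of_finrank_eq (by rw [Module.finrank_fin_fun]; exact h)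
  · intro h
    rw [Set.finrank, h, finrank_top, Module.finrank_fin_fun]

theorem centralSpace_eq_centralOn [Fintype ι] (Z : ι → Fin s → K) :
    centralSpace Z = centralOn Z Finset.univ := by
  rw [centralSpace, centralOn]
  congr 1
  ext p
  simp [finrank_image_eq_iff]

theorem centralSpace_subtype_ne [Fintype ι] [DecidableEq ι] (Z : ι → Fin s → K) (y : ι) :
    centralSpace (fun i : {i : ι // i ≠ y} => Z i) = centralOn Z (Finset.univ.erase y) := by
  have himage (Y : Finset {i : ι // i ≠ y}) :
      (fun i : {i : ι // i ≠ y} => Z i) '' {i | i ∉ Y} =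
        Z '' {i | i ∈ Finset.univ.erase y ∧ i ∉ Y.map (Function.Embedding.subtype _)} := by
    ext x
    constructor
    · rintro ⟨i, hi, rfl⟩
      refine ⟨i, ⟨by simpa using i.2, fun h => hi ?_⟩, rfl⟩
      simpa [i.2] using h
    · rintro ⟨i, ⟨hiy, hi⟩, rfl⟩
      have hiy' : i ≠ y := by simpa using hiy
      refine ⟨⟨i, hiy'⟩, fun h => hi ?_, rfl⟩
      simpa [hiy'] using h
  rw [centralSpace, centralOn]
  congr 1
  ext p
  constructor
  · rintro ⟨Y, hY, rfl⟩
    refine ⟨Y.map (Function.Embedding.subtype _), ?_, ?_, ?_⟩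
    · intro i hi
      obtain ⟨j, -, rfl⟩ := Finset.mem_map.1 hi
      simpa using j.2
    · rwa [finrank_image_eq_iff, himage] at hY
    · rw [Finset.prod_map]; rfl
  · rintro ⟨Y, hYA, hY, rfl⟩
    have hne : ∀ i ∈ Y, i ≠ y := fun i hi => by simpa using hYA hi
    have hmap : (Y.subtype (· ≠ y)).map (Function.Embedding.subtype _) = Y := by
      rw [Finset.subtype_map, Finset.filter_true_of_mem hne]
    refine ⟨Y.subtype (· ≠ y), ?_, ?_⟩
    · rwa [finrank_image_eq_iff, himage, hmap]
    · conv_lhs => rw [← hmap, Finset.prod_map]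
      rfl

/-- For a spanning list, intersecting the central spaces of all deletions lowers every bound on a
directional degree by one, because every hyperplane misses some vector of the list. -/
theorem internalSpace_eq_powerSpace [Fintype ι] [DecidableEq ι] {Z : ι → Fin s → K}
    (hZ : Submodule.span K (Set.range Z) = ⊤) :
    internalSpace Z = powerSpace 1 Z Finset.univ := by
  ext f
  simp only [internalSpace, centralSpace_subtype_ne, ← powerSpace_zero_eq_centralOn,
    Submodule.mem_iInf, mem_powerSpace]
  constructor
  · intro hf h hh
    obtain ⟨i, -, hi⟩ := exists_ne_zero_of_span_eq_top (S := Set.univ) (by rwa [Set.image_univ]) hh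
    have := hf i h hh
    rwa [Nat.sub_zero, ← Nat.add_sub_cancel (n := offCount Z (Finset.univ.erase i) h) (m := 1),
      offCount_erase_add_one (Finset.mem_univ i) hi] at this
  · intro hf y h hh
    refine (hf h hh).trans_le ?_
    by_cases hy : h (Z y) = 0
    · rw [offCount_erase_of_eq_zero _ hy]
      exact_mod_cast Nat.sub_le _ _
    · rw [← offCount_erase_add_one (Finset.mem_univ y) hy]
      exact_mod_cast Nat.le_refl _

end ListSpaces

/-! ### Ranks in the matroid of a list and in its dual -/

section MatroidRanks

variable {K : Type*} [Field K] {s s' : ℕ} {ι : Type*} [Fintype ι]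

theorem vectorMatroid_indep_iff (Z : ι → Fin s → K) (I : Set ι) :
    (vectorMatroid K Z).Indep I ↔ LinearIndepOn K Z I := by
  simp [vectorMatroid]

@[simp] theorem vectorMatroid_ground (Z : ι → Fin s → K) :
    (vectorMatroid K Z).E = Set.univ := rfl

theorem eRk_vectorMatroid (Z : ι → Fin s → K) (B : Finset ι) :
    (vectorMatroid K Z).eRk B = rankOn Z B := by
  classical
  obtain ⟨I, hI⟩ := (vectorMatroid K Z).exists_isBasis (B : Set ι)
  have hindep := (vectorMatroid_indep_iff Z I).1 hI.indep
  have hspan : Submodule.span K (Z '' B) = Submodule.span K (Z '' I) := by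
    refine le_antisymm (Submodule.span_le.2 ?_) (Submodule.span_mono (Set.image_mono hI.subset))
    rintro _ ⟨e, he, rfl⟩
    by_contra hns
    have hins := (vectorMatroid_indep_iff Z _).2 (hindep.insert hns)
    have heI := hI.mem_of_insert_indep he hins
    exact hns (Submodule.subset_span ⟨e, heI, rfl⟩)
  have : Fintype I := Fintype.ofFinite I
  rw [← hI.encard_eq_eRk, rankOn, hspan, Set.image_eq_range, finrank_span_eq_card hindep,
    ← Nat.card_eq_fintype_card, Nat.card_coe_set_eq, (Set.toFinite I).cast_ncard_eq]

theorem rk_vectorMatroid (Z : ι → Fin s → K) (B : Finset ι) :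
    rk (vectorMatroid K Z) B = rankOn Z B := by
  rw [rk, eRk_vectorMatroid, ENat.toNat_natCast]

theorem indep_iff_rankOn_eq_card (Z : ι → Fin s → K) (B : Finset ι) :
    (vectorMatroid K Z).Indep (B : Set ι) ↔ rankOn Z B = B.card := by
  rw [Matroid.indep_iff_eRk_eq_encard_of_finite B.finite_toSet, eRk_vectorMatroid,
    Set.encard_coe_eq_coe_finsetCard]
  exact Nat.cast_inj

/-- The rank function of the dual matroid. -/
theorem rankOn_compl_add [DecidableEq ι] {X : ι → Fin s → K} {Xd : ι → Fin s' → K}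
    (hX : Submodule.span K (Set.range X) = ⊤)
    (hXd : vectorMatroid K Xd = (vectorMatroid K X).dual) (A : Finset ι) :
    rankOn Xd Aᶜ + s + A.card = rankOn X A + Fintype.card ι := by
  have h := (vectorMatroid K X).eRk_dual_add_eRank ((Aᶜ : Finset ι) : Set ι) (Set.subset_univ _)
  have hE : (vectorMatroid K X).E \ ((Aᶜ : Finset ι) : Set ι) = A := by
    ext; simp
  have hr : (vectorMatroid K X).eRank = s := by
    rw [Matroid.eRank_def, vectorMatroid_ground, ← Finset.coe_univ, eRk_vectorMatroid,
      rankOn_eq_iff.2 (by rwa [Finset.coe_univ, Set.image_univ])]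
  rw [← hXd, hE, hr, eRk_vectorMatroid, eRk_vectorMatroid, Set.encard_coe_eq_coe_finsetCard] at h
  have h1 : rankOn Xd Aᶜ + s = rankOn X A + Aᶜ.card := by exact_mod_cast h
  have h2 := A.card_compl_add_card
  omega

end MatroidRanks

/-! ### Evaluation of the matroid polynomials -/

section Evaluation

variable {K : Type*} [Field K] {r s : ℕ} {ι : Type*} [Fintype ι] {F : Type*} [Field F]
  [Algebra ℤ F]

theorem subsets_vectorMatroid (X : ι → Fin r → K) :
    subsets (vectorMatroid K X) = Finset.univ := by
  simp [subsets]

theorem rk_vectorMatroid_ground {X : ι → Fin r → K} (hX : Submodule.span K (Set.range X) = ⊤) :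
    rk (vectorMatroid K X) (vectorMatroid K X).E = r := by
  rw [vectorMatroid_ground, ← Finset.coe_univ, rk_vectorMatroid,
    rankOn_eq_iff.2 (by rwa [Finset.coe_univ, Set.image_univ])]

theorem aeval_tuttePolynomial {X : ι → Fin r → K} (hX : Submodule.span K (Set.range X) = ⊤)
    (q y : F) : MvPolynomial.aeval ![q + 1, y] (tuttePolynomial (vectorMatroid K X)) =
      ∑ A : Finset ι, q ^ (r - rankOn X A) * (y - 1) ^ (A.card - rankOn X A) := by
  simp only [tuttePolynomial, subsets_vectorMatroid, rk_vectorMatroid_ground hX, rk_vectorMatroid,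
    map_sum, map_mul, map_pow, map_sub, MvPolynomial.aeval_X, map_one]
  simp

theorem aeval_charPolynomial {X : ι → Fin r → K} (hX : Submodule.span K (Set.range X) = ⊤)
    (q : F) : Polynomial.aeval q (charPolynomial (vectorMatroid K X)) =
      ∑ A : Finset ι, (-1) ^ A.card * q ^ (r - rankOn X A) := by
  simp only [charPolynomial, subsets_vectorMatroid, rk_vectorMatroid_ground hX, rk_vectorMatroid,
    map_sum, map_mul, map_pow, map_neg, Polynomial.aeval_X, map_one]

theorem aeval_fPolynomial {X : ι → Fin r → K} (hX : Submodule.span K (Set.range X) = ⊤)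
    (q : F) : Polynomial.aeval q (fPolynomial (vectorMatroid K X)) =
      ∑ A : Finset ι, if rankOn X A = A.card then q ^ (r - A.card) else 0 := by
  have hf (i : ℕ) : (fVector (vectorMatroid K X) i : F) =
      ∑ A : Finset ι, if rankOn X A = A.card ∧ A.card = i then 1 else 0 := by
    simp only [fVector, indep_iff_rankOn_eq_card, Finset.card_filter, Nat.cast_sum, Nat.cast_ite,
      Nat.cast_one, Nat.cast_zero]
  simp only [fPolynomial, rk_vectorMatroid_ground hX, map_sum, map_mul, map_pow, map_natCast,
    Polynomial.aeval_X, hf, Finset.sum_mul]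
  rw [Finset.sum_comm]
  refine Finset.sum_congr rfl fun A _ => ?_
  split_ifs with h
  · have hr := rankOn_le X A
    rw [Finset.sum_eq_single A.card]
    · simp [h]
    · intro i _ hi
      simp [hi.symm]
    · intro hA
      exact absurd (Finset.mem_range.2 (by omega)) hA
  · exact Finset.sum_eq_zero fun i _ => by simp [h]

theorem aeval_fPolynomial_eq {X : ι → Fin r → K} (hX : Submodule.span K (Set.range X) = ⊤)
    (q : F) : Polynomial.aeval q (fPolynomial (vectorMatroid K X)) =
      MvPolynomial.aeval ![q + 1, 1] (tuttePolynomial (vectorMatroid K X)) := by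
  rw [aeval_fPolynomial hX, aeval_tuttePolynomial hX, sub_self]
  refine Finset.sum_congr rfl fun A _ => ?_
  have hle := rankOn_le_card X A
  split_ifs with h
  · simp [h]
  · rw [zero_pow (by omega), mul_zero]

theorem aeval_charPolynomial_eq {X : ι → Fin r → K}
    (hX : Submodule.span K (Set.range X) = ⊤) (q : F) :
    (-1) ^ r * Polynomial.aeval (-q) (charPolynomial (vectorMatroid K X)) =
      MvPolynomial.aeval ![q + 1, 0] (tuttePolynomial (vectorMatroid K X)) := by
  rw [aeval_charPolynomial hX, aeval_tuttePolynomial hX, zero_sub, Finset.mul_sum]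
  refine Finset.sum_congr rfl fun A _ => ?_
  obtain ⟨a, ha⟩ := Nat.exists_eq_add_of_le (rankOn_le_card X A)
  obtain ⟨b, hb⟩ := Nat.exists_eq_add_of_le (rankOn_le X A)
  rw [show r - rankOn X A = b by omega, show A.card - rankOn X A = a by omega, ha, neg_pow q]
  have hpow : (-1 : F) ^ r = (-1) ^ rankOn X A * (-1) ^ b := by rw [← pow_add, ← hb]
  have h1 : ((-1 : F) ^ rankOn X A) ^ 2 = 1 := by rw [← pow_mul, mul_comm, pow_mul]; simp
  have h2 : ((-1 : F) ^ b) ^ 2 = 1 := by rw [← pow_mul, mul_comm, pow_mul]; simp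
  rw [pow_add, hpow]
  linear_combination (-1 : F) ^ a * q ^ b * ((-1 : F) ^ b) ^ 2 * h1 + (-1 : F) ^ a * q ^ b * h2

variable [DecidableEq ι] {X : ι → Fin r → K} {Xd : ι → Fin s → K}

/-- Complementing the sublists turns the expansion of the dual Tutte polynomial at `x = 1` into that
of the Tutte polynomial at `y = 1`. -/
theorem aeval_centralPoly (hX : Submodule.span K (Set.range X) = ⊤)
    (hXd : vectorMatroid K Xd = (vectorMatroid K X).dual) (hN : Fintype.card ι = r + s) {q : F}
    (hq : q + 1 ≠ 0) : MvPolynomial.aeval ![q + 1, 1] (tuttePolynomial (vectorMatroid K X)) =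
      (q + 1) ^ r * Polynomial.aeval (1 / (q + 1)) (centralPoly Xd Finset.univ) := by
  rw [aeval_tuttePolynomial hX, sub_self, centralPoly, map_sum, Finset.mul_sum,
    Finset.powerset_univ]
  refine Fintype.sum_equiv (compl_involutive.toPerm _) _ _ fun A => ?_
  have h := rankOn_compl_add hX hXd A
  have hle := rankOn_le_card X A
  have hc := A.card_compl_add_card
  rw [hN] at h hc
  rw [Function.Involutive.coe_toPerm, Finset.card_univ, hN]
  split_ifs with h1
  · obtain ⟨a, ha⟩ := Nat.exists_eq_add_of_le (rankOn_le X A)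
    rw [show A.card - rankOn X A = 0 by omega, show r - rankOn X A = a by omega,
      show Aᶜ.card - s = a by omega, show r + s - Aᶜ.card = rankOn X A by omega]
    have hpow : (q + 1) ^ r = (q + 1) ^ rankOn X A * (q + 1) ^ a := by rw [← pow_add, ← ha]
    simp only [map_mul, map_pow, map_sub, map_one, Polynomial.aeval_X, pow_zero, mul_one]
    have hq' : 1 - 1 / (q + 1) = q / (q + 1) := by field_simp; ring
    rw [hq', hpow, div_pow, div_pow, one_pow]
    field_simp
  · rw [zero_pow (by omega), mul_zero, map_zero, mul_zero]

theorem aeval_internalPoly (hX : Submodule.span K (Set.range X) = ⊤)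
    (hXd : vectorMatroid K Xd = (vectorMatroid K X).dual) (hN : Fintype.card ι = r + s) {q : F}
    (hq : q + 1 ≠ 0) : MvPolynomial.aeval ![q + 1, 0] (tuttePolynomial (vectorMatroid K X)) =
      (q + 1) ^ (r + s) * Polynomial.aeval (1 / (q + 1)) (internalPoly Xd Finset.univ) := by
  rw [aeval_tuttePolynomial hX, zero_sub, internalPoly, map_sum, Finset.mul_sum,
    Finset.powerset_univ]
  refine Fintype.sum_equiv (compl_involutive.toPerm _) _ _ fun A => ?_
  have h := rankOn_compl_add hX hXd A
  have hle := rankOn_le_card X A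
  have hc := A.card_compl_add_card
  rw [hN] at h hc
  rw [Function.Involutive.coe_toPerm, Finset.card_univ, hN]
  obtain ⟨a, ha⟩ := Nat.exists_eq_add_of_le (rankOn_le X A)
  obtain ⟨b, hb⟩ := Nat.exists_eq_add_of_le hle
  have hexp : r + s = a + (r + s - Aᶜ.card + rankOn Xd Aᶜ) := by omega
  rw [show A.card - rankOn X A = b by omega, show r - rankOn X A = a by omega,
    show Aᶜ.card - rankOn Xd Aᶜ = a by omega, show s + rankOn Xd Aᶜ = b + 2 * rankOn Xd Aᶜ by omega]
  generalize r + s - Aᶜ.card + rankOn Xd Aᶜ = c at hexp ⊢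
  rw [hexp]
  simp only [map_mul, map_pow, map_sub, map_neg, map_one, Polynomial.aeval_X]
  have hq' : 1 - 1 / (q + 1) = q / (q + 1) := by field_simp; ring
  rw [hq', pow_add, pow_add, pow_mul, neg_one_sq, one_pow, div_pow, div_pow, one_pow]
  field_simp

end Evaluation
end Zonotopal

open Zonotopal in
theorem mainTheorem7 {K : Type*} [Field K] [CharZero K] (N r : ℕ)
    (X : Fin N → Fin r → K) (hX : Submodule.span K (Set.range X) = ⊤)
    (Xd : Fin N → Fin (N - r) → K)
    (hXd : vectorMatroid K Xd = (vectorMatroid K X).dual) :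
    ∃ H Hint : Polynomial ℤ,
      (H : PowerSeries ℤ) = hilbertSeries (centralSpace Xd) ∧
      (Hint : PowerSeries ℤ) = hilbertSeries (internalSpace Xd) ∧
      ∀ q : RatFunc ℚ, q = RatFunc.X →
        Polynomial.aeval q (fPolynomial (vectorMatroid K X)) =
          MvPolynomial.aeval ![q + 1, 1] (tuttePolynomial (vectorMatroid K X)) ∧
        MvPolynomial.aeval ![q + 1, 1] (tuttePolynomial (vectorMatroid K X)) =
          (q + 1) ^ r * Polynomial.aeval (1 / (q + 1)) H ∧
        (-1) ^ r * Polynomial.aeval (-q) (charPolynomial (vectorMatroid K X)) =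
          MvPolynomial.aeval ![q + 1, 0] (tuttePolynomial (vectorMatroid K X)) ∧
        MvPolynomial.aeval ![q + 1, 0] (tuttePolynomial (vectorMatroid K X)) =
          (q + 1) ^ r * Polynomial.aeval (1 / (q + 1)) Hint := by
  have hrN : r ≤ N := by
    have h1 := rankOn_le_card X Finset.univ
    rwa [rankOn_eq_iff.2 (by rwa [Finset.coe_univ, Set.image_univ]), Finset.card_univ,
      Fintype.card_fin] at h1
  have hN : Fintype.card (Fin N) = r + (N - r) := by rw [Fintype.card_fin]; omega
  have hspan : Submodule.span K (Xd '' (Finset.univ : Finset (Fin N))) = ⊤ := by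
    have h := rankOn_compl_add hX hXd ∅
    have h0 : rankOn X ∅ = 0 := Nat.le_zero.1 (rankOn_le_card X ∅)
    rw [Finset.compl_empty, h0, hN, Finset.card_empty] at h
    exact rankOn_eq_iff.1 (by omega)
  have hser := X_pow_mul_hilbertSeries_powerSpace_one Xd Finset.univ hspan
  -- The internal polynomial is divisible by `t^(N - r)`, since it is so as a power series.
  obtain ⟨Hint, hHint⟩ : Polynomial.X ^ (N - r) ∣ internalPoly Xd Finset.univ := by
    rw [Polynomial.X_pow_dvd_iff]
    intro d hd
    rw [← Polynomial.coeff_coe, ← hser, PowerSeries.coeff_X_pow_mul', if_neg (by omega)]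
  refine ⟨centralPoly Xd Finset.univ, Hint, ?_, ?_, ?_⟩
  · rw [centralSpace_eq_centralOn, hilbertSeries_centralOn_eq]
  · rw [internalSpace_eq_powerSpace (by rwa [Finset.coe_univ, Set.image_univ] at hspan)]
    rw [hHint, Polynomial.coe_mul, Polynomial.coe_pow, Polynomial.coe_X] at hser
    exact (mul_left_cancel₀ (pow_ne_zero _ PowerSeries.X_ne_zero) hser).symm
  · rintro q rfl
    have hq : (RatFunc.X + 1 : RatFunc ℚ) ≠ 0 := by
      rw [← RatFunc.algebraMap_X, ← map_one (algebraMap (Polynomial ℚ) (RatFunc ℚ)), ← map_add]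
      exact RatFunc.algebraMap_ne_zero (Polynomial.X_add_C_ne_zero 1)
    refine ⟨aeval_fPolynomial_eq hX _, aeval_centralPoly hX hXd hN hq,
      aeval_charPolynomial_eq hX _, ?_⟩
    rw [aeval_internalPoly hX hXd hN hq, hHint, map_mul, map_pow, Polynomial.aeval_X, pow_add,
      mul_assoc, ← mul_assoc _ _ (Polynomial.aeval _ Hint), ← mul_pow, mul_one_div_cancel hq,
      one_pow, one_mul]
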